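/- Let $\mathbb S=\{y_0<y_1<\dots<y_N\}\subset\mathbb R$ be a finite set and let $Y$ be a right-continuous continuous-time Markov chain on $\mathbb S$ with transition rate matrix $\bm G=(G(x,y))_{x,y\in\mathbb S}$, where $G(x,y)\ge 0$ for $y\ne x$ and $G(x,x)=-\sum_{y\neq x}G(x,y)$, and where $y_0$ and $y_N$ are absorbing; under $\mathbb P_x$ (with expectation $\mathbb E_x$) the chain starts at $Y_0=x$ and has transition matrices $e^{t\bm G}$, $t\ge 0$. Let $a>0$. Put $\tilde\tau_{a,0}=0$ and, for $n\ge 1$, \[\tilde\tau_{a,n}=\inf\Big\{t>\tilde\tau_{a,n-1}:\ \sup_{\tilde\tau_{a,n-1}\le u\le t}Y_u-Y_t\ge a\Big\}\in[0,\infty],\qquad \inf\emptyset=\infty ,\] the $n$-th drawdown time without recovery. For $A\subseteq\mathbb R$ let $T_A=\inf\{t>0:\ Y_t\notin A\}$, and for $q\in\mathbb C$ and $f:\mathbb S\to\mathbb C$ let \[P_A(q,x;f)=\mathbb E_x\big[e^{-qT_A}\mathbf 1_{\{T_A<\infty\}}f(Y_{T_A})\big].\] Let $q\in\mathbb C$ with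 $\Re(q)>0$. For every $x\in\mathbb S$ the expectations below are those of integrable random variables, the series \[H(q,x):=\sum_{k=1}^\infty \mathbb E_x\big[e^{-q\tilde\tau_{a,k}}\big]\qquad(\text{with } e^{-q\cdot\infty}:=0)\] converges absolutely, and $H(q,\cdot)$ satisfies the linear system \[H(q,x)=\sum_{y\in\mathbb S,\,y\le x-a}P_{(x-a,x]}(q,x;\mathbf 1_{\{\cdot=y\}})\,(1+H(q,y))+\sum_{y\in\mathbb S,\,y>x}P_{(x-a,x]}(q,x;\mathbf 1_{\{\cdot=y\}})\,H(q,y),\qquad x\in\mathbb S .\] Moreover, for every real $r_f$ with $\Re(q)+r_f>0$ (in particular every $r_f\ge 0$), the price $V(T)=\sum_{k=1}^{\infty}\mathbb E_x\big[e^{-r_f\tilde\tau_{a,k}}\mathbf 1_{\{\tilde\tau_{a,k}<T\}}\big]$ of the drawdown insurance without recovery with maturity $T$ is finite for every $T>0$, the function $T\mapsto e^{-qT}V(T)$ is integrable on $(0,\infty)$, and \[\int_0^\infty e^{-qT}\,V(T)\,dT=\frac{H(q+r_f,x)}{q}.\] -/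

import Mathlib

open MeasureTheory
open scoped NNReal ENNReal

noncomputable section

/-- `G` is a transition rate matrix on the finite grid `S ⊆ ℝ`: nonnegative off the diagonal,
and every diagonal entry is minus the sum of the other entries of its row. -/
structure IsRateMatrix {S : Finset ℝ} (G : Matrix S S ℝ) : Prop where
  offDiag_nonneg : ∀ x y : S, y ≠ x → 0 ≤ G x y
  diag_eq : ∀ x : S, G x x = -∑ y ∈ Finset.univ.erase x, G x y

/-- The state `x` is absorbing: all rates out of it vanish. -/
def IsAbsorbingState {S : Finset ℝ} (G : Matrix S S ℝ) (x : S) : Prop :=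
  ∀ y : S, G x y = 0

/-- `Y`, under the family of laws `ℙ x` (`x ∈ S`), is a continuous-time Markov chain on `S` with
transition rate matrix `G`: it has right-continuous paths, starts at `x` under `ℙ x`, and its
finite-dimensional distributions are those of the Markov chain with transition matrices
`p(t) = exp (t G)`, that is, for `0 = t₀ ≤ t₁ ≤ … ≤ tₙ` and `y₀ = x`,
`ℙ x (Y_{t₁} = y₁, …, Y_{tₙ} = yₙ) = ∏_{i < n} p(tᵢ₊₁ - tᵢ)(yᵢ, yᵢ₊₁)`. -/
structure IsCTMC {Ω : Type*} [MeasurableSpace Ω] {S : Finset ℝ} (G : Matrix S S ℝ)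
    (ℙ : S → Measure Ω) (Y : ℝ≥0 → Ω → S) : Prop where
  isProbabilityMeasure : ∀ x : S, IsProbabilityMeasure (ℙ x)
  measurable : ∀ t : ℝ≥0, Measurable (Y t)
  rightContinuous : ∀ (ω : Ω) (t : ℝ≥0), ContinuousWithinAt (fun s => Y s ω) (Set.Ici t) t
  start : ∀ x : S, ∀ᵐ ω ∂(ℙ x), Y 0 ω = x
  finDimDistr : ∀ (x : S) (n : ℕ) (t : ℕ → ℝ≥0) (y : ℕ → S),
    Monotone t → t 0 = 0 → y 0 = x →
      (ℙ x).real {ω | ∀ i < n, Y (t (i + 1)) ω = y (i + 1)} =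
        ∏ i ∈ Finset.range n,
          NormedSpace.exp (((t (i + 1) : ℝ) - (t i : ℝ)) • G) (y i) (y (i + 1))

/-- First passage time `T_A = inf {t > 0 : Y_t ∉ A}`, with `inf ∅ = ∞`. -/
def firstPassageTime {Ω : Type*} {S : Finset ℝ} (Y : ℝ≥0 → Ω → S) (A : Set ℝ) (ω : Ω) : ℝ≥0∞ :=
  ⨅ (t : ℝ≥0) (_ : 0 < t ∧ (Y t ω : ℝ) ∉ A), (t : ℝ≥0∞)

/-- The random variable `exp (-∫₀^{T_A} k(Y_s) ds) 1_{T_A < ∞} f(Y_{T_A})`. -/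
def firstPassagePayoff {Ω : Type*} {S : Finset ℝ} (Y : ℝ≥0 → Ω → S) (A : Set ℝ)
    (k f : S → ℂ) (ω : Ω) : ℂ :=
  if firstPassageTime Y A ω < ∞ then
    Complex.exp (-∫ s in (0 : ℝ)..(firstPassageTime Y A ω).toReal, k (Y s.toNNReal ω)) *
      f (Y (firstPassageTime Y A ω).toNNReal ω)
  else 0

/-- `P_A(k, x; f) = 𝔼_x[exp (-∫₀^{T_A} k(Y_s) ds) 1_{T_A < ∞} f(Y_{T_A})]`. -/
def firstPassageValue {Ω : Type*} [MeasurableSpace Ω] {S : Finset ℝ} (ℙ : S → Measure Ω)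
    (Y : ℝ≥0 → Ω → S) (A : Set ℝ) (k : S → ℂ) (x : S) (f : S → ℂ) : ℂ :=
  ∫ ω, firstPassagePayoff Y A k f ω ∂(ℙ x)

/-- The running supremum `sup_{s ≤ u ≤ t} Y_u`, where `s` may be given in `[0, ∞]`. -/
def runningSup {Ω : Type*} {S : Finset ℝ} (Y : ℝ≥0 → Ω → S) (s : ℝ≥0∞) (t : ℝ≥0) (ω : Ω) : ℝ :=
  sSup ((fun u : ℝ≥0 => (Y u ω : ℝ)) '' {u : ℝ≥0 | s ≤ u ∧ u ≤ t})

/-- The `n`-th drawdown time without recovery: `τ₀ = 0` and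
`τₙ₊₁ = inf {t > τₙ : sup_{τₙ ≤ u ≤ t} Y_u - Y_t ≥ a}`, with `inf ∅ = ∞`. -/
def drawdownTime {Ω : Type*} {S : Finset ℝ} (Y : ℝ≥0 → Ω → S) (a : ℝ) : ℕ → Ω → ℝ≥0∞
  | 0, _ => 0
  | n + 1, ω =>
    ⨅ (t : ℝ≥0) (_ : drawdownTime Y a n ω < t ∧
      a ≤ runningSup Y (drawdownTime Y a n ω) t ω - (Y t ω : ℝ)), (t : ℝ≥0∞)

/-- The discount factor `e^{-q τ}` for a time `τ ∈ [0, ∞]`, with `e^{-q ∞} = 0`. -/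
def discount (q : ℂ) (τ : ℝ≥0∞) : ℂ :=
  if τ < ∞ then Complex.exp (-q * (τ.toReal : ℂ)) else 0

/-- `𝔼_x[e^{-q τₙ}]` for the `n`-th drawdown time without recovery. -/
def drawdownTransform {Ω : Type*} [MeasurableSpace Ω] {S : Finset ℝ} (ℙ : S → Measure Ω)
    (Y : ℝ≥0 → Ω → S) (a : ℝ) (q : ℂ) (n : ℕ) (x : S) : ℂ :=
  ∫ ω, discount q (drawdownTime Y a n ω) ∂(ℙ x)

/-- `H(q, x) = ∑_{k ≥ 1} 𝔼_x[e^{-q τₖ}]`. -/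
def drawdownSeries {Ω : Type*} [MeasurableSpace Ω] {S : Finset ℝ} (ℙ : S → Measure Ω)
    (Y : ℝ≥0 → Ω → S) (a : ℝ) (q : ℂ) (x : S) : ℂ :=
  ∑' k : ℕ, drawdownTransform ℙ Y a q (k + 1) x

/-- The payment for the `n`-th drawdown with maturity `T`, discounted at the rate `r`:
`e^{-r τₙ} 1_{τₙ < T}`. -/
def insurancePayment {Ω : Type*} {S : Finset ℝ} (Y : ℝ≥0 → Ω → S) (a r T : ℝ) (n : ℕ)
    (ω : Ω) : ℝ :=
  if drawdownTime Y a n ω < ENNReal.ofReal T then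
    Real.exp (-r * (drawdownTime Y a n ω).toReal)
  else 0

/-- The price `∑_{k ≥ 1} 𝔼_x[e^{-r τₖ} 1_{τₖ < T}]` of the drawdown insurance without recovery
with maturity `T`. -/
def insurancePrice {Ω : Type*} [MeasurableSpace Ω] {S : Finset ℝ} (ℙ : S → Measure Ω)
    (Y : ℝ≥0 → Ω → S) (a r T : ℝ) (x : S) : ℝ :=
  ∑' k : ℕ, ∫ ω, insurancePayment Y a r T (k + 1) ω ∂(ℙ x)

end

/-!
A right-continuous process with discrete values that is Markov at fixed times is strongly Markov at
optional times `T`: approximate `T` from the right by times in a grid, at which the path eventually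
takes the same values as at `T`.

Let `T` be the exit time of the chain, started at `x`, from `(x - a, x]`. No drawdown occurs before
`T`. If the chain leaves downwards, `T` is the first drawdown time, and the later ones are `T` plus
the drawdown times of the path shifted by `T`. If it leaves upwards, the path is above all its
earlier values at time `T`, so all drawdown times are `T` plus those of the shifted path. With
`hₖ x = 𝔼_x[e^{-q τₖ}]` and `P x y = 𝔼_x[e^{-q T} 1_{Y_T = y}]`, the strong Markov property at `T`
gives `hₖ₊₁ x = ∑_{y ≤ x - a} P x y hₖ y + ∑_{y > x} P x y hₖ₊₁ y`. Since `T > 0`, the rows of `|P|`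
sum to at most some `ρ < 1`, hence `‖hₖ₊₁‖ ≤ ρ max ‖hₖ‖ ‖hₖ₊₁‖` in the supremum norm. This forces
`‖hₖ₊₁‖ ≤ ρ ‖hₖ‖`, so that `∑ hₖ` converges, and summing the recursion over `k` gives the linear
system.

Let `ν` be the sum over `k ≥ 1` of the laws of `τₖ`. Then `H(q, x) = ∫ e^{-q τ} dν(τ)` and
`V(T) = ∫ e^{-r τ} 1_{τ < T} dν(τ)`, and the Laplace transform of `V` follows by Fubini's theorem
from `∫_τ^∞ e^{-q T} dT = e^{-q τ} / q`.
-/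

noncomputable section

section PathSpace

variable {ι E : Type*}

/-- The cylinder of the functions that agree with `v` on the finite index set `J`. -/
def pointCylinder (J : Finset ι) (v : ι → E) : Set (ι → E) :=
  {p | ∀ i ∈ J, p i = v i}

variable [MeasurableSpace E] [MeasurableSingletonClass E]

lemma measurableSet_pointCylinder (J : Finset ι) (v : ι → E) :
    MeasurableSet (pointCylinder J v) := by
  simp only [pointCylinder, Set.ofPred_forall]
  exact Finset.measurableSet_biInter J fun i _ =>
    (measurableSet_singleton (v i)).preimage (measurable_pi_apply (X := fun _ : ι => E) i)

lemma measure_ext_of_pointCylinder [Countable E] {μ ν : Measure (ι → E)} [IsFiniteMeasure μ]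
    [IsFiniteMeasure ν]
    (h : ∀ (J : Finset ι) (v : ι → E), μ (pointCylinder J v) = ν (pointCylinder J v)) :
    μ = ν := by
  classical
  rcases isEmpty_or_nonempty (ι → E) with hempty | ⟨⟨p₀⟩⟩
  · exact Measure.ext fun s _ => by simp [Set.eq_empty_of_isEmpty s]
  refine IsProjectiveLimit.unique (P := fun J => ν.map J.restrict) (fun J => ?_) (fun J => rfl)
  refine Measure.ext_iff_singleton.2 fun f => ?_
  have hJ : Measurable (J.restrict : (ι → E) → (J → E)) := Finset.measurable_restrict J
  have hpreimage : (J.restrict : (ι → E) → (J → E)) ⁻¹' {f} =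
      pointCylinder J fun i => if hi : i ∈ J then f ⟨i, hi⟩ else p₀ i := by
    ext p
    simp +contextual [pointCylinder, funext_iff]
  rw [Measure.map_apply hJ (measurableSet_singleton f),
    Measure.map_apply hJ (measurableSet_singleton f), hpreimage, h]

end PathSpace

section Past

variable {Ω E : Type*} [MeasurableSpace E] {Y : ℝ≥0 → Ω → E} {s t : ℝ≥0}

/-- The `σ`-algebra generated by the process `Y` up to time `s`, encoded as the one generated by
the path stopped at time `s`. -/
@[reducible] def past (Y : ℝ≥0 → Ω → E) (s : ℝ≥0) : MeasurableSpace Ω :=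
  MeasurableSpace.comap (fun ω u => Y (min u s) ω) inferInstance

lemma measurable_past (h : t ≤ s) : Measurable[past Y s] (Y t) := by
  have hstopped := (measurable_pi_apply (X := fun _ : ℝ≥0 => E) t).comp
    (comap_measurable fun ω u => Y (min u s) ω)
  simpa only [Function.comp_def, min_eq_left h] using hstopped

lemma past_mono (h : s ≤ t) : past Y s ≤ past Y t :=
  Measurable.comap_le (@measurable_pi_lambda _ _ _ (past Y t) _ _
    fun u => measurable_past ((min_le_right u s).trans h))

lemma past_le [MeasurableSpace Ω] (hY : ∀ t, Measurable (Y t)) (s : ℝ≥0) :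
    past Y s ≤ ‹MeasurableSpace Ω› :=
  Measurable.comap_le (measurable_pi_lambda _ fun u => hY (min u s))

end Past

/-- The path of `Y` after the time `s`. -/
def shiftedPath {Ω E : Type*} (Y : ℝ≥0 → Ω → E) (s : ℝ≥0) (ω : Ω) : ℝ≥0 → E :=
  fun t => Y (s + t) ω

/-- `Y` is a right-continuous time-homogeneous Markov process under the family of laws `ℙ x`, where
`x` is the initial state. The Markov property is required for cylinders in the future only, since
these determine the law of a process with countably many states. -/
structure IsMarkovFamily {Ω E : Type*} [MeasurableSpace Ω] [MeasurableSpace E] [TopologicalSpace E]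
    (ℙ : E → Measure Ω) (Y : ℝ≥0 → Ω → E) : Prop where
  isProbabilityMeasure : ∀ x, IsProbabilityMeasure (ℙ x)
  measurable : ∀ t, Measurable (Y t)
  rightContinuous : ∀ ω t, ContinuousWithinAt (fun s => Y s ω) (Set.Ici t) t
  start : ∀ x, ∀ᵐ ω ∂(ℙ x), Y 0 ω = x
  measure_inter_shiftedPath : ∀ (x y : E) (s : ℝ≥0) (A : Set Ω), MeasurableSet[past Y s] A →
    ∀ (J : Finset ℝ≥0) (v : ℝ≥0 → E),
      ℙ x (A ∩ {ω | Y s ω = y} ∩ {ω | shiftedPath Y s ω ∈ pointCylinder J v}) =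
        ℙ x (A ∩ {ω | Y s ω = y}) * ℙ y {ω | (fun t => Y t ω) ∈ pointCylinder J v}

section RateMatrix

lemma exists_monotone_enumeration (K : Finset ℝ≥0) :
    ∃ (n : ℕ) (t : ℕ → ℝ≥0), Monotone t ∧ t 0 = 0 ∧ ∀ s, s ∈ K ↔ ∃ i < n, t (i + 1) = s := by
  induction K using Finset.induction_on_max with
  | empty => exact ⟨0, 0, monotone_const, rfl, by simp⟩
  | insert m K hm ih =>
    obtain ⟨n, t, ht, ht0, hK⟩ := ih
    have hle : ∀ i ≤ n, t i ≤ m := by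
      rintro (_ | i) hi
      · simp [ht0]
      · exact (hm _ ((hK _).2 ⟨i, hi, rfl⟩)).le
    refine ⟨n + 1, fun i => if i ≤ n then t i else m, fun i j hij => ?_, by simp [ht0],
      fun s => ?_⟩
    · dsimp only
      split_ifs with hi hj
      · exact ht hij
      · exact hle i hi
      · omega
      · exact le_rfl
    · rw [Finset.mem_insert, hK, Nat.exists_lt_succ_right, or_comm]
      refine or_congr (exists_congr fun i => and_congr_right fun hi => ?_) ?_
      · simp only [if_pos (Nat.succ_le_of_lt hi)]
      · simp [eq_comm]

lemma forall_lt_add_iff {m n : ℕ} {p : ℕ → Prop} :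
    (∀ i < m + n, p i) ↔ (∀ i < m, p i) ∧ ∀ i < n, p (m + i) := by
  refine ⟨fun h => ⟨fun i hi => h i (by omega), fun i hi => h _ (by omega)⟩,
    fun ⟨h, h'⟩ i hi => ?_⟩
  rcases lt_or_ge i m with him | him
  · exact h i him
  · obtain ⟨k, rfl⟩ := Nat.exists_eq_add_of_le him
    exact h' k (by omega)

/-- The sequence that follows `f` up to the index `n` and then continues with `g 1, g 2, …`. -/
def concatAt {α : Type*} (n : ℕ) (f g : ℕ → α) (i : ℕ) : α :=
  if i ≤ n then f i else g (i - n)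

lemma concatAt_of_le {α : Type*} {n i : ℕ} (f g : ℕ → α) (hi : i ≤ n) : concatAt n f g i = f i :=
  if_pos hi

lemma concatAt_add {α : Type*} {n : ℕ} {f g : ℕ → α} (h : g 0 = f n) (i : ℕ) :
    concatAt n f g (n + i) = g i := by
  rcases i with _ | i <;> simp [concatAt, h]

lemma monotone_concatAt {α : Type*} [Preorder α] {n : ℕ} {f g : ℕ → α} (hf : Monotone f)
    (hg : Monotone g) (h : g 0 = f n) : Monotone (concatAt n f g) := fun i j hij => by
  unfold concatAt
  split_ifs with hi hj
  · exact hf hij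
  · exact (hf hi).trans (h ▸ hg (Nat.zero_le _))
  · exact absurd (hij.trans ‹_›) hi
  · exact hg (Nat.sub_le_sub_right hij n)

variable {Ω : Type*} [MeasurableSpace Ω] {S : Finset ℝ} {G : Matrix S S ℝ} {ℙ : S → Measure Ω}
  {Y : ℝ≥0 → Ω → S}

lemma IsCTMC.measureReal_concat (hY : IsCTMC G ℙ Y) (n n' : ℕ) {t t' : ℕ → ℝ≥0} {y y' : ℕ → S}
    (ht : Monotone t) (ht' : Monotone t') (ht0 : t 0 = 0) (ht0' : t' 0 = 0) (hy' : y' 0 = y n) :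
    (ℙ (y 0)).real ({ω | ∀ i < n, Y (t (i + 1)) ω = y (i + 1)} ∩
        {ω | ∀ i < n', Y (t n + t' (i + 1)) ω = y' (i + 1)}) =
      (ℙ (y 0)).real {ω | ∀ i < n, Y (t (i + 1)) ω = y (i + 1)} *
        (ℙ (y n)).real {ω | ∀ i < n', Y (t' (i + 1)) ω = y' (i + 1)} := by
  let τ := concatAt n t fun i => t n + t' i
  let w := concatAt n y y'
  have hτ_left : ∀ i ≤ n, τ i = t i := fun i hi => concatAt_of_le _ _ hi
  have hw_left : ∀ i ≤ n, w i = y i := fun i hi => concatAt_of_le _ _ hi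
  have hτ_right : ∀ i, τ (n + i) = t n + t' i := concatAt_add (by simp [ht0'])
  have hw_right : ∀ i, w (n + i) = y' i := concatAt_add hy'
  have hτ : Monotone τ :=
    monotone_concatAt ht (fun i j hij => by gcongr; exact ht' hij) (by simp [ht0'])
  have hevent : {ω | ∀ i < n, Y (t (i + 1)) ω = y (i + 1)} ∩
      {ω | ∀ i < n', Y (t n + t' (i + 1)) ω = y' (i + 1)} =
        {ω | ∀ i < n + n', Y (τ (i + 1)) ω = w (i + 1)} := by
    ext ω
    rw [Set.mem_inter_iff, Set.mem_ofPred_eq, Set.mem_ofPred_eq, Set.mem_ofPred_eq,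
      forall_lt_add_iff]
    refine and_congr (forall₂_congr fun i hi => ?_) (forall₂_congr fun i _ => ?_)
    · rw [hτ_left _ hi, hw_left _ hi]
    · rw [add_assoc, hτ_right, hw_right]
  rw [hevent, hY.finDimDistr _ _ τ w hτ (by simp [hτ_left, ht0]) (hw_left 0 (Nat.zero_le n)),
    hY.finDimDistr _ _ t y ht ht0 rfl, hY.finDimDistr _ _ t' y' ht' ht0' hy',
    Finset.prod_range_add]
  congr 1
  · refine Finset.prod_congr rfl fun i hi => ?_
    have hin := Finset.mem_range.1 hi
    rw [hτ_left _ hin, hτ_left _ hin.le, hw_left _ hin, hw_left _ hin.le]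
  · refine Finset.prod_congr rfl fun i _ => ?_
    rw [add_assoc, hτ_right, hτ_right, hw_right, hw_right, NNReal.coe_add, NNReal.coe_add,
      add_sub_add_left_eq_sub]

lemma IsCTMC.measureReal_inter_shiftedPath (hY : IsCTMC G ℙ Y) (x : S) {s : ℝ≥0} {K : Finset ℝ≥0}
    (hs : IsGreatest (K : Set ℝ≥0) s) (J : Finset ℝ≥0) (v v' : ℝ≥0 → S) :
    (ℙ x).real ({ω | (fun t => Y t ω) ∈ pointCylinder K v} ∩
        {ω | shiftedPath Y s ω ∈ pointCylinder J v'}) =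
      (ℙ x).real {ω | (fun t => Y t ω) ∈ pointCylinder K v} *
        (ℙ (v s)).real {ω | (fun t => Y t ω) ∈ pointCylinder J v'} := by
  obtain ⟨n, t, ht, ht0, hK⟩ := exists_monotone_enumeration K
  obtain ⟨n', t', ht', ht0', hJ⟩ := exists_monotone_enumeration J
  obtain ⟨i, hin, hi⟩ := (hK s).1 hs.1
  obtain ⟨k, rfl⟩ : ∃ k, n = k + 1 := ⟨n - 1, by omega⟩
  have hts : t (k + 1) = s :=
    le_antisymm (hs.2 ((hK _).2 ⟨k, by omega, rfl⟩)) (hi ▸ ht (by omega))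
  let y : ℕ → S := fun i => i.casesOn x fun i => v (t (i + 1))
  let y' : ℕ → S := fun i => i.casesOn (v s) fun i => v' (t' (i + 1))
  have hconcat : y' 0 = y (k + 1) := congrArg v hts.symm
  simpa [pointCylinder, shiftedPath, hK, hJ, y, y', hts] using
    hY.measureReal_concat (k + 1) n' ht ht' ht0 ht0' hconcat

lemma IsCTMC.map_restrict_shiftedPath (hY : IsCTMC G ℙ Y) (x y : S) (s : ℝ≥0) (J : Finset ℝ≥0)
    (v : ℝ≥0 → S) :
    ((ℙ x).restrict ({ω | Y s ω = y} ∩ {ω | shiftedPath Y s ω ∈ pointCylinder J v})).map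
        (fun ω u => Y (min u s) ω) =
      (ℙ y {ω | (fun t => Y t ω) ∈ pointCylinder J v}).toNNReal •
        ((ℙ x).restrict {ω | Y s ω = y}).map (fun ω u => Y (min u s) ω) := by
  have := hY.isProbabilityMeasure
  have hstopped : Measurable fun ω u => Y (min u s) ω :=
    measurable_pi_lambda _ fun u => hY.measurable (min u s)
  refine measure_ext_of_pointCylinder fun I w => ?_
  have hI := measurableSet_pointCylinder I w
  rw [Measure.smul_apply, ENNReal.smul_def, ENNReal.coe_toNNReal (measure_ne_top _ _),
    smul_eq_mul, mul_comm, Measure.map_apply hstopped hI, Measure.map_apply hstopped hI,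
    Measure.restrict_apply (hstopped hI), Measure.restrict_apply (hstopped hI), ← Set.inter_assoc]
  rcases Set.eq_empty_or_nonempty
    ((fun ω u => Y (min u s) ω) ⁻¹' pointCylinder I w ∩ {ω | Y s ω = y}) with hempty | ⟨ω₀, h₀, hω₀⟩
  · simp [hempty]
  let K := insert s (I.image (min · s))
  have hs : IsGreatest (K : Set ℝ≥0) s := ⟨by simp [K], by simp [K, mem_upperBounds]⟩
  have hpast : (fun ω u => Y (min u s) ω) ⁻¹' pointCylinder I w ∩ {ω | Y s ω = y} =
      {ω | (fun t => Y t ω) ∈ pointCylinder K fun t => Y t ω₀} := by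
    ext ω
    simp only [pointCylinder, Set.mem_inter_iff, Set.mem_preimage, Set.mem_ofPred_eq, K,
      Finset.forall_mem_insert, Finset.forall_mem_image] at h₀ hω₀ ⊢
    rw [hω₀, and_comm]
    exact and_congr_right fun _ => forall₂_congr fun i hi => by rw [h₀ i hi]
  have hmarkov := hY.measureReal_inter_shiftedPath x hs J (fun t => Y t ω₀) v
  rw [← hpast, show Y s ω₀ = y from hω₀] at hmarkov
  simpa only [measureReal_def, ← ENNReal.toReal_mul,
    ENNReal.toReal_eq_toReal_iff' (measure_ne_top _ _)
      (ENNReal.mul_ne_top (measure_ne_top _ _) (measure_ne_top _ _))] using hmarkov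

lemma IsCTMC.isMarkovFamily (hY : IsCTMC G ℙ Y) : IsMarkovFamily ℙ Y where
  isProbabilityMeasure := hY.isProbabilityMeasure
  measurable := hY.measurable
  rightContinuous := hY.rightContinuous
  start := hY.start
  measure_inter_shiftedPath := by
    rintro x y s _ ⟨B, hB, rfl⟩ J v
    have := hY.isProbabilityMeasure
    have hstopped : Measurable fun ω u => Y (min u s) ω :=
      measurable_pi_lambda _ fun u => hY.measurable (min u s)
    have hmap := congrArg (· B) (hY.map_restrict_shiftedPath x y s J v)
    simp only [Measure.smul_apply, ENNReal.smul_def, ENNReal.coe_toNNReal (measure_ne_top _ _),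
      smul_eq_mul, Measure.map_apply hstopped hB, Measure.restrict_apply (hstopped hB)] at hmap
    rw [Set.inter_assoc, hmap, mul_comm]

end RateMatrix

section Grid

open Filter Topology

/-- The approximation of a time `τ` from the right by the grid of mesh `1 / (m + 1)`. -/
def gridAbove (m : ℕ) (τ : ℝ≥0) : ℝ≥0 := ((⌊(m + 1) * τ⌋₊ + 1 : ℕ) : ℝ≥0) / (m + 1)

lemma gridAbove_eq_iff {m j : ℕ} {τ : ℝ≥0} :
    gridAbove m τ = ((j + 1 : ℕ) : ℝ≥0) / (m + 1) ↔
      τ < ((j + 1 : ℕ) : ℝ≥0) / (m + 1) ∧ (j : ℝ≥0) / (m + 1) ≤ τ := by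
  rw [gridAbove, div_left_inj' (by positivity), Nat.cast_inj, add_left_inj,
    Nat.floor_eq_iff zero_le, lt_div_iff₀ (by positivity), div_le_iff₀ (by positivity),
    mul_comm τ, and_comm, Nat.cast_add_one]

lemma lt_gridAbove (m : ℕ) (τ : ℝ≥0) : τ < gridAbove m τ :=
  (gridAbove_eq_iff.1 rfl).1

lemma gridAbove_le (m : ℕ) (τ : ℝ≥0) : gridAbove m τ ≤ τ + 1 / (m + 1) := by
  rw [gridAbove, Nat.cast_add_one, add_div]
  gcongr
  exact (gridAbove_eq_iff.1 rfl).2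

lemma countable_range_gridAbove {α : Type*} (m : ℕ) (τ : α → ℝ≥0) :
    (Set.range fun ω => gridAbove m (τ ω)).Countable :=
  (Set.countable_range fun j : ℕ => ((j + 1 : ℕ) : ℝ≥0) / (m + 1)).mono
    (by rintro _ ⟨ω, rfl⟩; exact ⟨_, rfl⟩)

lemma tendsto_gridAbove (τ : ℝ≥0) : Tendsto (gridAbove · τ) atTop (𝓝[≥] τ) := by
  refine tendsto_nhdsWithin_iff.2 ⟨?_, .of_forall fun m => (lt_gridAbove m τ).le⟩
  have hmesh : Tendsto (fun m : ℕ => τ + 1 / ((m : ℝ≥0) + 1)) atTop (𝓝 τ) := by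
    simpa using (tendsto_one_div_add_atTop_nhds_zero_nat (𝕜 := ℝ≥0)).const_add τ
  exact tendsto_of_tendsto_of_tendsto_of_le_of_le tendsto_const_nhds hmesh
    (fun m => (lt_gridAbove m τ).le) fun m => gridAbove_le m τ

lemma eventually_gridAbove_add_eq {E : Type*} [TopologicalSpace E] [DiscreteTopology E]
    {p : ℝ≥0 → E} (hp : ∀ t, ContinuousWithinAt p (Set.Ici t) t) (τ t : ℝ≥0) :
    ∀ᶠ m in atTop, p (gridAbove m τ + t) = p (τ + t) := by
  have hadd : Tendsto (· + t) (𝓝[≥] τ) (𝓝[≥] (τ + t)) :=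
    (continuous_add_const t).continuousWithinAt.tendsto_nhdsWithin
      fun s (hs : τ ≤ s) => add_le_add_left hs t
  have hright := (hp (τ + t)).tendsto
  rw [nhds_discrete, tendsto_pure] at hright
  exact (hadd.comp (tendsto_gridAbove τ)).eventually hright

end Grid

section OptionalTime

open Filter Topology

/-- `T` is an optional time of the process `Y`: the event `T < s` is determined by the process up
to time `s`. -/
def IsOptionalTime {Ω E : Type*} [MeasurableSpace E] (Y : ℝ≥0 → Ω → E) (T : Ω → ℝ≥0∞) : Prop :=
  ∀ s : ℝ≥0, MeasurableSet[past Y s] {ω | T ω < s}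

/-- The event that the time `T` is finite and that `Y` is then in the state `y`. -/
def stoppedAt {Ω E : Type*} (Y : ℝ≥0 → Ω → E) (T : Ω → ℝ≥0∞) (y : E) : Set Ω :=
  {ω | T ω < ∞} ∩ {ω | Y (T ω).toNNReal ω = y}

lemma measurable_of_forall_measurableSet_lt {Ω : Type*} [MeasurableSpace Ω] {T : Ω → ℝ≥0∞}
    (h : ∀ s : ℝ≥0, MeasurableSet {ω | T ω < s}) : Measurable T := by
  refine measurable_of_Iio fun c => ?_
  induction c with
  | top =>
    have hfinite : T ⁻¹' Set.Iio ⊤ = ⋃ n : ℕ, {ω | T ω < (n : ℝ≥0)} := by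
      ext ω
      simp only [Set.mem_preimage, Set.mem_Iio, Set.mem_iUnion, Set.mem_ofPred_eq,
        ENNReal.coe_natCast]
      exact ⟨fun h => ENNReal.exists_nat_gt h.ne, fun ⟨n, hn⟩ => hn.trans (by simp)⟩
    exact hfinite ▸ .iUnion fun n => h n
  | coe c => exact h c

variable {Ω E : Type*} [MeasurableSpace Ω] [MeasurableSpace E] {Y : ℝ≥0 → Ω → E}
  {T : Ω → ℝ≥0∞}

lemma IsOptionalTime.measurable (hT : IsOptionalTime Y T) (hY : ∀ t, Measurable (Y t)) :
    Measurable T :=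
  measurable_of_forall_measurableSet_lt fun s => past_le hY s _ (hT s)

/-- The `σ`-algebra `ℱ_{T+}` of the events that are determined by the process up to immediately
after the optional time `T`. -/
@[reducible] def IsOptionalTime.measurableSpace (hT : IsOptionalTime Y T) : MeasurableSpace Ω where
  MeasurableSet' A := MeasurableSet A ∧ ∀ s : ℝ≥0, MeasurableSet[past Y s] (A ∩ {ω | T ω < s})
  measurableSet_empty := ⟨.empty, fun s => by simp⟩
  measurableSet_compl A hA := ⟨hA.1.compl, fun s => by
    have hdiff : Aᶜ ∩ {ω | T ω < s} = {ω | T ω < s} \ (A ∩ {ω | T ω < s}) := by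
      ext ω
      simp only [Set.mem_inter_iff, Set.mem_compl_iff, Set.mem_sdiff]
      tauto
    exact hdiff ▸ (hT s).diff (hA.2 s)⟩
  measurableSet_iUnion A hA := ⟨.iUnion fun i => (hA i).1, fun s => by
    rw [Set.iUnion_inter]
    exact .iUnion fun i => (hA i).2 s⟩

lemma IsOptionalTime.measurableSpace_le (hT : IsOptionalTime Y T) :
    hT.measurableSpace ≤ ‹MeasurableSpace Ω› := fun _ hA => hA.1

lemma IsOptionalTime.measurable_measurableSpace (hT : IsOptionalTime Y T)
    (hY : ∀ t, Measurable (Y t)) : Measurable[hT.measurableSpace] T := by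
  refine @measurable_of_forall_measurableSet_lt _ hT.measurableSpace _ fun r =>
    ⟨past_le hY r _ (hT r), fun s => ?_⟩
  have hmin : {ω | T ω < r} ∩ {ω | T ω < s} = {ω | T ω < (min r s : ℝ≥0)} := by
    ext ω
    simp
  exact hmin ▸ past_mono (min_le_right r s) _ (hT _)

lemma IsOptionalTime.measurableSet_inter_gridAbove_eq (hT : IsOptionalTime Y T) {A : Set Ω}
    (hA : MeasurableSet[hT.measurableSpace] A) (m : ℕ) (s : ℝ≥0) :
    MeasurableSet[past Y s] (A ∩ {ω | T ω < ∞} ∩ {ω | gridAbove m (T ω).toNNReal = s}) := by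
  by_cases hs : ∃ j : ℕ, ((j + 1 : ℕ) : ℝ≥0) / (m + 1) = s
  · obtain ⟨j, rfl⟩ := hs
    have hdiff : A ∩ {ω | T ω < ∞} ∩
        {ω | gridAbove m (T ω).toNNReal = ((j + 1 : ℕ) : ℝ≥0) / (m + 1)} =
          (A ∩ {ω | T ω < (((j + 1 : ℕ) : ℝ≥0) / (m + 1) : ℝ≥0)}) \
            (A ∩ {ω | T ω < ((j : ℝ≥0) / (m + 1) : ℝ≥0)}) := by
      ext ω
      simp only [Set.mem_inter_iff, Set.mem_sdiff, Set.mem_ofPred_eq, gridAbove_eq_iff]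
      induction T ω with
      | top => simp
      | coe τ =>
        simp only [ENNReal.coe_lt_coe, ENNReal.toNNReal_coe, ENNReal.coe_lt_top, and_true]
        grind
    rw [hdiff]
    refine (hA.2 _).diff (past_mono ?_ _ (hA.2 _))
    gcongr
    simp
  · have hempty : A ∩ {ω | T ω < ∞} ∩ {ω | gridAbove m (T ω).toNNReal = s} = ∅ :=
      Set.eq_empty_of_forall_notMem fun ω hω => hs ⟨_, hω.2⟩
    exact hempty ▸ @MeasurableSet.empty _ (past Y s)

lemma measurable_eval_of_countable (hY : ∀ t, Measurable (Y t)) (s : ℕ → ℝ≥0) {N : Ω → ℕ}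
    (hN : Measurable N) : Measurable fun ω => Y (s (N ω)) ω := by
  have hsampled : Measurable fun z : Ω × ℕ => Y (s z.2) z.1 :=
    measurable_from_prod_countable_left fun j => hY (s j)
  exact hsampled.comp (measurable_id.prodMk hN)

lemma measurable_eval_gridAbove (hY : ∀ t, Measurable (Y t)) {τ : Ω → ℝ≥0} (hτ : Measurable τ)
    (m : ℕ) (t : ℝ≥0) : Measurable fun ω => Y (gridAbove m (τ ω) + t) ω :=
  measurable_eval_of_countable hY (fun j => ((j + 1 : ℕ) : ℝ≥0) / (m + 1) + t)
    (Nat.measurable_floor.comp (hτ.const_mul ((m : ℝ≥0) + 1)))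

lemma measure_eq_tsum_inter_fiber {Ω β : Type*} [MeasurableSpace Ω] (μ : Measure Ω) {f : Ω → β}
    (hf : (Set.range f).Countable) {A : Set Ω}
    (hA : ∀ b, MeasurableSet (A ∩ {ω | f ω = b})) :
    μ A = ∑' b : Set.range f, μ (A ∩ {ω | f ω = b}) := by
  have := hf.to_subtype
  rw [← measure_iUnion _ fun b : Set.range f => hA b, ← Set.inter_iUnion]
  · congr 1
    ext ω
    simp
  · exact fun b c hbc => Set.disjoint_left.2 fun ω hb hc => hbc (Subtype.ext (hb.2.symm.trans hc.2))

variable [TopologicalSpace E] [MeasurableSingletonClass E] {ℙ : E → Measure Ω}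

lemma IsMarkovFamily.measure_inter_shiftedPath_of_countable_range (hY : IsMarkovFamily ℙ Y)
    (x y : E) {τ : Ω → ℝ≥0} (hτ : (Set.range τ).Countable) {A : Set Ω}
    (hA : ∀ s, MeasurableSet[past Y s] (A ∩ {ω | τ ω = s})) (J : Finset ℝ≥0) (v : ℝ≥0 → E) :
    ℙ x (A ∩ {ω | Y (τ ω) ω = y} ∩ {ω | shiftedPath Y (τ ω) ω ∈ pointCylinder J v}) =
      ℙ x (A ∩ {ω | Y (τ ω) ω = y}) * ℙ y {ω | (fun t => Y t ω) ∈ pointCylinder J v} := by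
  have hA_fiber : ∀ s, A ∩ {ω | Y (τ ω) ω = y} ∩ {ω | τ ω = s} =
      A ∩ {ω | τ ω = s} ∩ {ω | Y s ω = y} := fun s => by
    ext ω
    simp only [Set.mem_inter_iff, Set.mem_ofPred_eq]
    grind
  have hJ_fiber : ∀ s, A ∩ {ω | Y (τ ω) ω = y} ∩
      {ω | shiftedPath Y (τ ω) ω ∈ pointCylinder J v} ∩ {ω | τ ω = s} =
        A ∩ {ω | τ ω = s} ∩ {ω | Y s ω = y} ∩ {ω | shiftedPath Y s ω ∈ pointCylinder J v} :=
    fun s => by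
      ext ω
      simp only [Set.mem_inter_iff, Set.mem_ofPred_eq]
      grind
  have hA_meas : ∀ s, MeasurableSet (A ∩ {ω | τ ω = s} ∩ {ω | Y s ω = y}) := fun s =>
    (past_le hY.measurable s _ (hA s)).inter (hY.measurable s (measurableSet_singleton y))
  have hJ_meas : ∀ s, MeasurableSet {ω | shiftedPath Y s ω ∈ pointCylinder J v} := fun s =>
    (measurable_pi_lambda _ fun t => hY.measurable (s + t)) (measurableSet_pointCylinder J v)
  rw [measure_eq_tsum_inter_fiber _ hτ fun s => hJ_fiber s ▸ (hA_meas s).inter (hJ_meas s),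
    measure_eq_tsum_inter_fiber _ hτ fun s => hA_fiber s ▸ hA_meas s, ← ENNReal.tsum_mul_right]
  refine tsum_congr fun s => ?_
  rw [hA_fiber, hJ_fiber]
  exact hY.measure_inter_shiftedPath x y s _ (hA s) J v

variable [DiscreteTopology E]

lemma IsMarkovFamily.tendsto_measure_gridAbove (hY : IsMarkovFamily ℙ Y) (x y : E) {τ : Ω → ℝ≥0}
    (hτ : Measurable τ) {A : Set Ω} (hA : MeasurableSet A) (J : Finset ℝ≥0) (v : ℝ≥0 → E) :
    Tendsto (fun m => ℙ x (A ∩ {ω | Y (gridAbove m (τ ω)) ω = y} ∩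
        {ω | shiftedPath Y (gridAbove m (τ ω)) ω ∈ pointCylinder J v})) atTop
      (𝓝 (ℙ x (A ∩ {ω | Y (τ ω) ω = y} ∩ {ω | shiftedPath Y (τ ω) ω ∈ pointCylinder J v}))) := by
  have := hY.isProbabilityMeasure x
  refine tendsto_measure_of_tendsto_indicator_of_isFiniteMeasure atTop (ℙ x) (fun m => ?_)
    fun ω => ?_
  · have hstate := measurable_eval_gridAbove hY.measurable hτ m
    have hstate_zero := hstate 0 (measurableSet_singleton y)
    simp only [add_zero] at hstate_zero
    exact (hA.inter hstate_zero).inter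
      (measurable_pi_lambda _ hstate (measurableSet_pointCylinder J v))
  · have hstate := eventually_gridAbove_add_eq (hY.rightContinuous ω) (τ ω)
    filter_upwards [hstate 0, (eventually_all_finset J).2 fun j _ => hstate j] with m h0 hJ
    rw [add_zero, add_zero] at h0
    simp only [Set.mem_inter_iff, Set.mem_ofPred_eq, h0, pointCylinder, shiftedPath]
    exact and_congr_right fun _ => forall₂_congr fun j hj => by rw [hJ j hj]

lemma IsMarkovFamily.strongMarkov_pointCylinder (hY : IsMarkovFamily ℙ Y) (x y : E)
    (hT : IsOptionalTime Y T) {A : Set Ω} (hA : MeasurableSet[hT.measurableSpace] A)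
    (J : Finset ℝ≥0) (v : ℝ≥0 → E) :
    ℙ x (A ∩ stoppedAt Y T y ∩ {ω | shiftedPath Y (T ω).toNNReal ω ∈ pointCylinder J v}) =
      ℙ x (A ∩ stoppedAt Y T y) * ℙ y {ω | (fun t => Y t ω) ∈ pointCylinder J v} := by
  have := hY.isProbabilityMeasure
  have hT' := hT.measurable hY.measurable
  have hA' : MeasurableSet (A ∩ {ω | T ω < ∞}) := hA.1.inter (measurableSet_lt hT' measurable_const)
  have hlim := hY.tendsto_measure_gridAbove x y hT'.ennreal_toNNReal hA'
  have hlim_future := hlim J v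
  have hlim_state := hlim ∅ v
  simp only [hY.measure_inter_shiftedPath_of_countable_range x y (countable_range_gridAbove _ _)
    (hT.measurableSet_inter_gridAbove_eq hA _)] at hlim_future
  simp only [pointCylinder, Finset.notMem_empty, false_imp_iff, implies_true, Set.ofPred_true,
    Set.inter_univ, Set.mem_univ] at hlim_state
  rw [stoppedAt, ← Set.inter_assoc]
  exact tendsto_nhds_unique hlim_future
    (ENNReal.Tendsto.mul_const hlim_state (.inr (measure_ne_top _ _)))

variable [Countable E]

lemma IsMarkovFamily.measurable_shiftedPath (hY : IsMarkovFamily ℙ Y) {τ : Ω → ℝ≥0}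
    (hτ : Measurable τ) : Measurable fun ω => shiftedPath Y (τ ω) ω := by
  refine measurable_pi_lambda _ fun t => ?_
  refine measurable_of_tendsto_metrizable (measurable_eval_gridAbove hY.measurable hτ · t) ?_
  refine tendsto_pi_nhds.2 fun ω => tendsto_const_nhds.congr' ?_
  exact (eventually_gridAbove_add_eq (hY.rightContinuous ω) (τ ω) t).mono fun _ => Eq.symm

lemma IsMarkovFamily.measurableSet_stoppedAt (hY : IsMarkovFamily ℙ Y) (hT : IsOptionalTime Y T)
    (y : E) : MeasurableSet (stoppedAt Y T y) := by
  have hT' := hT.measurable hY.measurable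
  have hstate := (measurable_pi_apply (X := fun _ : ℝ≥0 => E) 0).comp
    (hY.measurable_shiftedPath hT'.ennreal_toNNReal)
  simp only [Function.comp_def, shiftedPath, add_zero] at hstate
  exact (measurableSet_lt hT' measurable_const).inter (hstate (measurableSet_singleton y))

lemma IsMarkovFamily.strongMarkov (hY : IsMarkovFamily ℙ Y) (x y : E)
    (hT : IsOptionalTime Y T) {A : Set Ω} (hA : MeasurableSet[hT.measurableSpace] A)
    {C : Set (ℝ≥0 → E)} (hC : MeasurableSet C) :
    ℙ x (A ∩ stoppedAt Y T y ∩ {ω | shiftedPath Y (T ω).toNNReal ω ∈ C}) =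
      ℙ x (A ∩ stoppedAt Y T y) * ℙ y {ω | (fun t => Y t ω) ∈ C} := by
  have := hY.isProbabilityMeasure
  have hpath : Measurable fun ω t => Y t ω := measurable_pi_lambda _ hY.measurable
  have hshift := hY.measurable_shiftedPath (hT.measurable hY.measurable).ennreal_toNNReal
  set c := ℙ x (A ∩ stoppedAt Y T y)
  have hlaw : ((ℙ x).restrict (A ∩ stoppedAt Y T y)).map
      (fun ω => shiftedPath Y (T ω).toNNReal ω) = c.toNNReal • (ℙ y).map fun ω t => Y t ω := by
    refine measure_ext_of_pointCylinder fun J v => ?_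
    have hJ := measurableSet_pointCylinder J v
    rw [Measure.map_apply hshift hJ, Measure.restrict_apply (hshift hJ), Measure.smul_apply,
      Measure.map_apply hpath hJ, ENNReal.smul_def, ENNReal.coe_toNNReal (measure_ne_top _ _),
      Set.inter_comm]
    exact hY.strongMarkov_pointCylinder x y hT hA J v
  have hlawC := congrArg (· C) hlaw
  simp only [Measure.map_apply hshift hC, Measure.restrict_apply (hshift hC), Measure.smul_apply,
    Measure.map_apply hpath hC, ENNReal.smul_def, c, ENNReal.coe_toNNReal (measure_ne_top _ _),
    smul_eq_mul] at hlawC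
  rwa [Set.inter_comm]

lemma IsMarkovFamily.map_prodMk_shiftedPath {β : Type*} [MeasurableSpace β]
    (hY : IsMarkovFamily ℙ Y) (x y : E) (hT : IsOptionalTime Y T) {X : Ω → β}
    (hX : Measurable[hT.measurableSpace] X) :
    ((ℙ x).restrict (stoppedAt Y T y)).map
        (fun ω => (X ω, shiftedPath Y (T ω).toNNReal ω)) =
      (((ℙ x).restrict (stoppedAt Y T y)).map X).prod ((ℙ y).map fun ω t => Y t ω) := by
  have := hY.isProbabilityMeasure
  have hX' : Measurable X := hX.mono hT.measurableSpace_le le_rfl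
  have hpath : Measurable fun ω t => Y t ω := measurable_pi_lambda _ hY.measurable
  have hshift := hY.measurable_shiftedPath (hT.measurable hY.measurable).ennreal_toNNReal
  refine (Measure.prod_eq fun B C hB hC => ?_).symm
  rw [Measure.map_apply (hX'.prodMk hshift) (hB.prod hC),
    Measure.restrict_apply ((hX'.prodMk hshift) (hB.prod hC)), Measure.map_apply hX' hB,
    Measure.restrict_apply (hX' hB), Measure.map_apply hpath hC, Set.mk_preimage_prod,
    Set.inter_right_comm]
  exact hY.strongMarkov x y hT (hX hB) hC

lemma IsMarkovFamily.setIntegral_mul_shiftedPath {𝕜 : Type*} [RCLike 𝕜]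
    (hY : IsMarkovFamily ℙ Y) (x y : E) (hT : IsOptionalTime Y T) {X : Ω → 𝕜}
    (hX : Measurable[hT.measurableSpace] X) {g : (ℝ≥0 → E) → 𝕜} (hg : Measurable g) :
    ∫ ω in stoppedAt Y T y, X ω * g (shiftedPath Y (T ω).toNNReal ω) ∂(ℙ x) =
      (∫ ω in stoppedAt Y T y, X ω ∂(ℙ x)) * ∫ ω, g (fun t => Y t ω) ∂(ℙ y) := by
  have := hY.isProbabilityMeasure
  have hX' : Measurable X := hX.mono hT.measurableSpace_le le_rfl
  have hpath : Measurable fun ω t => Y t ω := measurable_pi_lambda _ hY.measurable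
  have hshift := hY.measurable_shiftedPath (hT.measurable hY.measurable).ennreal_toNNReal
  have hmap := integral_map (μ := (ℙ x).restrict (stoppedAt Y T y))
    (hX'.prodMk hshift).aemeasurable (f := fun z => z.1 * g z.2)
    (measurable_fst.mul (hg.comp measurable_snd)).aestronglyMeasurable
  rw [← hmap, hY.map_prodMk_shiftedPath x y hT hX, integral_prod_mul (fun z => z) g,
    integral_map hX'.aemeasurable (f := fun z => z) aestronglyMeasurable_id,
    integral_map hpath.aemeasurable hg.aestronglyMeasurable]

end OptionalTime

section Drawdown

open TopologicalSpace

lemma exists_denseSeq_eq {E : Type*} [TopologicalSpace E] [DiscreteTopology E] {p : ℝ≥0 → E}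
    {t s : ℝ≥0} (hp : ContinuousWithinAt p (Set.Ici t) t) (hts : t < s) :
    ∃ i, t < denseSeq ℝ≥0 i ∧ denseSeq ℝ≥0 i < s ∧ p (denseSeq ℝ≥0 i) = p t := by
  obtain ⟨b, htb, hb⟩ :=
    mem_nhdsGE_iff_exists_Ico_subset.1 (hp (isOpen_discrete {p t} |>.mem_nhds rfl))
  obtain ⟨_, ⟨i, rfl⟩, hti, his⟩ :=
    (denseRange_denseSeq ℝ≥0).exists_between (lt_min (Set.mem_Ioi.1 htb) hts)
  exact ⟨i, hti, his.trans_le (min_le_right _ _), hb ⟨hti.le, his.trans_le (min_le_left _ _)⟩⟩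

variable {Ω : Type*} {S : Finset ℝ} {Y : ℝ≥0 → Ω → S} {A : Set ℝ} {ω : Ω}

lemma firstPassageTime_lt_iff (hY : ∀ t, ContinuousWithinAt (fun s => Y s ω) (Set.Ici t) t)
    (A : Set ℝ) (s : ℝ≥0) :
    firstPassageTime Y A ω < s ↔ ∃ i, 0 < denseSeq ℝ≥0 i ∧ denseSeq ℝ≥0 i < s ∧
      (Y (denseSeq ℝ≥0 i) ω : ℝ) ∉ A := by
  simp only [firstPassageTime, iInf_lt_iff]
  constructor
  · rintro ⟨t, ⟨ht, htA⟩, hts⟩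
    obtain ⟨i, hti, his, hi⟩ := exists_denseSeq_eq (hY t) (ENNReal.coe_lt_coe.1 hts)
    exact ⟨i, ht.trans hti, his, by rwa [hi]⟩
  · rintro ⟨i, hpos, his, hi⟩
    exact ⟨_, ⟨hpos, hi⟩, ENNReal.coe_lt_coe.2 his⟩

lemma isOptionalTime_firstPassageTime
    (hY : ∀ ω t, ContinuousWithinAt (fun s => Y s ω) (Set.Ici t) t) (A : Set ℝ) :
    IsOptionalTime Y (firstPassageTime Y A) := by
  intro s
  simp only [firstPassageTime_lt_iff (hY _), Set.ofPred_exists, Set.ofPred_and]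
  refine MeasurableSet.iUnion fun i => (MeasurableSet.const _).inter ?_
  by_cases hi : denseSeq ℝ≥0 i < s
  · exact (MeasurableSet.const _).inter
      (measurable_past hi.le (MeasurableSet.of_discrete (s := {y : S | (y : ℝ) ∉ A})))
  · simp [hi]

lemma mem_of_lt_firstPassageTime (h0 : (Y 0 ω : ℝ) ∈ A) {t : ℝ≥0}
    (ht : t < firstPassageTime Y A ω) : (Y t ω : ℝ) ∈ A := by
  rcases eq_or_ne t 0 with rfl | ht0
  · exact h0
  · by_contra hA
    exact (iInf₂_le t ⟨pos_of_ne_zero ht0, hA⟩ : firstPassageTime Y A ω ≤ t).not_gt ht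

lemma notMem_of_firstPassageTime_eq {T : ℝ≥0}
    (hY : ContinuousWithinAt (fun s => Y s ω) (Set.Ici T) T)
    (hT : firstPassageTime Y A ω = T) : (Y T ω : ℝ) ∉ A := by
  intro hA
  obtain ⟨b, hTb, hb⟩ :=
    mem_nhdsGE_iff_exists_Ico_subset.1 (hY (isOpen_discrete {Y T ω} |>.mem_nhds rfl))
  have hTb' := hT.trans_lt (ENNReal.coe_lt_coe.2 hTb)
  simp only [firstPassageTime, iInf_lt_iff] at hTb'
  obtain ⟨t, ht, htb⟩ := hTb'
  have hTt : T ≤ t := ENNReal.coe_le_coe.1 (hT ▸ iInf₂_le t ht)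
  have hstay : Y t ω = Y T ω := hb ⟨hTt, ENNReal.coe_lt_coe.1 htb⟩
  exact ht.2 (hstay ▸ hA)

lemma firstPassageTime_pos (hY : ContinuousWithinAt (fun s => Y s ω) (Set.Ici 0) 0)
    (h0 : (Y 0 ω : ℝ) ∈ A) : 0 < firstPassageTime Y A ω :=
  pos_of_ne_zero fun h => notMem_of_firstPassageTime_eq hY h h0

/-- The first time after `s` at which the path `p` has fallen by at least `a` from a value it took
since `s`. For a path whose running suprema are attained, this is the first time at which the
drawdown from the running supremum since `s` is at least `a`. -/
def nextDrawdownTime (p : ℝ≥0 → ℝ) (a : ℝ) (s : ℝ≥0∞) : ℝ≥0∞ :=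
  ⨅ (t : ℝ≥0) (_ : s < t ∧ ∃ u : ℝ≥0, s ≤ u ∧ u ≤ t ∧ a ≤ p u - p t), (t : ℝ≥0∞)

section NextDrawdownTime

variable {p : ℝ≥0 → ℝ} {a x : ℝ} {T : ℝ≥0}

lemma nextDrawdownTime_top (p : ℝ≥0 → ℝ) (a : ℝ) : nextDrawdownTime p a ⊤ = ⊤ := by
  simp [nextDrawdownTime]

lemma nextDrawdownTime_add (p : ℝ≥0 → ℝ) (a : ℝ) (T : ℝ≥0) (s : ℝ≥0∞) :
    nextDrawdownTime p a (T + s) = T + nextDrawdownTime (fun t => p (T + t)) a s := by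
  have hadd_lt : ∀ t : ℝ≥0, T + s < (T + t : ℝ≥0) ↔ s < t := fun t => by
    rw [ENNReal.coe_add, ENNReal.add_lt_add_iff_left ENNReal.coe_ne_top]
  have hadd_le : ∀ t : ℝ≥0, T + s ≤ (T + t : ℝ≥0) ↔ s ≤ t := fun t => by
    rw [ENNReal.coe_add, ENNReal.add_le_add_iff_left ENNReal.coe_ne_top]
  refine le_antisymm (tsub_le_iff_left.1 (le_iInf₂ fun t ht => tsub_le_iff_left.2 ?_))
    (le_iInf₂ fun t ht => ?_)
  · obtain ⟨hst, u, hsu, hut, hdrop⟩ := ht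
    rw [← ENNReal.coe_add]
    exact iInf₂_le (T + t) ⟨(hadd_lt t).2 hst, T + u, (hadd_le u).2 hsu, by gcongr, hdrop⟩
  · obtain ⟨hst, u, hsu, hut, hdrop⟩ := ht
    obtain ⟨u, rfl⟩ := exists_add_of_le (ENNReal.coe_le_coe.1 (le_self_add.trans hsu))
    obtain ⟨t, rfl⟩ := exists_add_of_le (le_self_add.trans hut)
    rw [ENNReal.coe_add]
    gcongr
    exact iInf₂_le t ⟨(hadd_lt t).1 hst, u, (hadd_le u).1 hsu, (add_le_add_iff_left T).1 hut, hdrop⟩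

lemma le_nextDrawdownTime_zero {T : ℝ≥0∞} (hp : ∀ t : ℝ≥0, t < T → p t ∈ Set.Ioc (x - a) x) :
    T ≤ nextDrawdownTime p a 0 := by
  refine le_iInf₂ fun t ⟨_, u, _, hut, hdrop⟩ => ?_
  by_contra! htT
  have hu := (hp u ((ENNReal.coe_le_coe.2 hut).trans_lt htT)).2
  have ht := (hp t htT).1
  linarith

lemma nextDrawdownTime_zero_of_down (ha : 0 < a) (h0 : p 0 = x)
    (hp : ∀ t < T, p t ∈ Set.Ioc (x - a) x) (hT : p T ≤ x - a) :
    nextDrawdownTime p a 0 = T := by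
  refine le_antisymm ?_ (le_nextDrawdownTime_zero fun t ht => hp t (ENNReal.coe_lt_coe.1 ht))
  have hpos : 0 < T := pos_of_ne_zero fun h => by
    rw [h, h0] at hT
    linarith
  exact iInf₂_le T ⟨ENNReal.coe_pos.2 hpos, 0, le_rfl, zero_le, by linarith⟩

lemma nextDrawdownTime_zero_of_up (ha : 0 < a) (hp : ∀ t < T, p t ∈ Set.Ioc (x - a) x)
    (hT : x < p T) :
    nextDrawdownTime p a 0 = T + nextDrawdownTime (fun t => p (T + t)) a 0 := by
  rw [← nextDrawdownTime_add, add_zero]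
  refine le_antisymm (le_iInf₂ fun t ht => ?_) (le_iInf₂ fun t ht => ?_)
  · obtain ⟨hTt, u, _, hut, hdrop⟩ := ht
    exact iInf₂_le t ⟨zero_le.trans_lt hTt, u, zero_le, hut, hdrop⟩
  obtain ⟨ht0, u, _, hut, hdrop⟩ := ht
  have hnext : nextDrawdownTime p a 0 ≤ t := iInf₂_le t ⟨ht0, u, zero_le, hut, hdrop⟩
  have hle : T ≤ t := ENNReal.coe_le_coe.1
    ((le_nextDrawdownTime_zero fun t ht => hp t (ENNReal.coe_lt_coe.1 ht)).trans hnext)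
  -- A drawdown from a time before `T` is also one from `T`, where the path is higher.
  obtain ⟨v, hTv, hvt, hdrop⟩ : ∃ v, T ≤ v ∧ v ≤ t ∧ a ≤ p v - p t := by
    rcases lt_or_ge u T with hu | hu
    · exact ⟨T, le_rfl, hle, by linarith [(hp u hu).2]⟩
    · exact ⟨u, hu, hut, hdrop⟩
  have hTt : T < t := hTv.trans_lt (hvt.lt_of_ne fun h => by
    rw [h, sub_self] at hdrop
    exact hdrop.not_gt ha)
  exact iInf₂_le t ⟨ENNReal.coe_lt_coe.2 hTt, v, ENNReal.coe_le_coe.2 hTv, hvt, hdrop⟩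

end NextDrawdownTime

lemma le_runningSup_sub_iff {s : ℝ≥0∞} {t : ℝ≥0} (hst : s ≤ t) (a : ℝ) :
    a ≤ runningSup Y s t ω - (Y t ω : ℝ) ↔
      ∃ u : ℝ≥0, s ≤ u ∧ u ≤ t ∧ a ≤ (Y u ω : ℝ) - Y t ω := by
  have hfinite : ((fun u : ℝ≥0 => (Y u ω : ℝ)) '' {u : ℝ≥0 | s ≤ u ∧ u ≤ t}).Finite :=
    S.finite_toSet.subset (by rintro _ ⟨u, -, rfl⟩; exact (Y u ω).2)
  constructor
  · intro h
    have hnonempty : {u : ℝ≥0 | s ≤ u ∧ u ≤ t}.Nonempty := ⟨t, hst, le_rfl⟩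
    obtain ⟨u, ⟨hsu, hut⟩, hu⟩ := (hnonempty.image _).csSup_mem hfinite
    exact ⟨u, hsu, hut, h.trans_eq (by rw [runningSup, ← hu])⟩
  · rintro ⟨u, hsu, hut, hu⟩
    exact hu.trans (sub_le_sub_right (le_csSup hfinite.bddAbove ⟨u, ⟨hsu, hut⟩, rfl⟩) _)

variable {a : ℝ} {n k : ℕ} {x : S} {T : ℝ≥0}

lemma drawdownTime_succ (Y : ℝ≥0 → Ω → S) (a : ℝ) (n : ℕ) (ω : Ω) :
    drawdownTime Y a (n + 1) ω =
      nextDrawdownTime (fun t => Y t ω) a (drawdownTime Y a n ω) := by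
  rw [drawdownTime, nextDrawdownTime]
  exact iInf_congr fun t =>
    iInf_congr_Prop (and_congr_right fun h => le_runningSup_sub_iff h.le a) fun _ => rfl

lemma drawdownTime_one (Y : ℝ≥0 → Ω → S) (a : ℝ) (ω : Ω) :
    drawdownTime Y a 1 ω = nextDrawdownTime (fun t => Y t ω) a 0 :=
  drawdownTime_succ Y a 0 ω

lemma drawdownTime_succ_eq_add_shift
    (h : drawdownTime Y a n ω = T + drawdownTime (fun t => Y (T + t)) a k ω) :
    drawdownTime Y a (n + 1) ω = T + drawdownTime (fun t => Y (T + t)) a (k + 1) ω := by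
  rw [drawdownTime_succ, drawdownTime_succ, h, nextDrawdownTime_add]

lemma drawdownTime_eq_top (ha : 0 < a) (h0 : Y 0 ω = x)
    (hT : firstPassageTime Y (Set.Ioc ((x : ℝ) - a) x) ω = ⊤) (k : ℕ) :
    drawdownTime Y a (k + 1) ω = ⊤ := by
  induction k with
  | zero =>
    rw [drawdownTime_one, ← top_le_iff, ← hT]
    exact le_nextDrawdownTime_zero fun t => mem_of_lt_firstPassageTime (by simp [h0, ha])
  | succ k ih => rw [drawdownTime_succ, ih, nextDrawdownTime_top]

lemma mem_Ioc_of_lt_of_firstPassageTime_eq (ha : 0 < a) (h0 : Y 0 ω = x)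
    (hT : firstPassageTime Y (Set.Ioc ((x : ℝ) - a) x) ω = T) (t : ℝ≥0) (ht : t < T) :
    (Y t ω : ℝ) ∈ Set.Ioc ((x : ℝ) - a) x :=
  mem_of_lt_firstPassageTime (by simp [h0, ha]) (hT ▸ ENNReal.coe_lt_coe.2 ht)

lemma drawdownTime_of_down (ha : 0 < a) (h0 : Y 0 ω = x)
    (hT : firstPassageTime Y (Set.Ioc ((x : ℝ) - a) x) ω = T) (hdown : (Y T ω : ℝ) ≤ x - a)
    (k : ℕ) :
    drawdownTime Y a (k + 1) ω = T + drawdownTime (fun t => Y (T + t)) a k ω := by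
  induction k with
  | zero =>
    rw [drawdownTime_one, drawdownTime, add_zero]
    exact nextDrawdownTime_zero_of_down ha (congrArg Subtype.val h0)
      (mem_Ioc_of_lt_of_firstPassageTime_eq ha h0 hT) hdown
  | succ k ih => exact drawdownTime_succ_eq_add_shift ih

lemma drawdownTime_of_up (ha : 0 < a) (h0 : Y 0 ω = x)
    (hT : firstPassageTime Y (Set.Ioc ((x : ℝ) - a) x) ω = T) (hup : (x : ℝ) < Y T ω) (k : ℕ) :
    drawdownTime Y a (k + 1) ω = T + drawdownTime (fun t => Y (T + t)) a (k + 1) ω := by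
  induction k with
  | zero =>
    rw [drawdownTime_one, drawdownTime_one]
    exact nextDrawdownTime_zero_of_up ha (mem_Ioc_of_lt_of_firstPassageTime_eq ha h0 hT) hup
  | succ k ih => exact drawdownTime_succ_eq_add_shift ih

/-- The `n`-th drawdown time without recovery, computed from the values of the path on a countable
dense set of times, which makes it a measurable function of the path. -/
def denseDrawdownTime (a : ℝ) : ℕ → (ℝ≥0 → S) → ℝ≥0∞
  | 0, _ => 0
  | n + 1, p => ⨅ i : ℕ, ⨅ j : ℕ,
      if denseDrawdownTime a n p ≤ denseSeq ℝ≥0 i ∧ denseSeq ℝ≥0 i < denseSeq ℝ≥0 j ∧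
        a ≤ (p (denseSeq ℝ≥0 i) : ℝ) - p (denseSeq ℝ≥0 j) then (denseSeq ℝ≥0 j : ℝ≥0∞) else ⊤

lemma measurable_denseDrawdownTime (a : ℝ) (n : ℕ) :
    Measurable (denseDrawdownTime (S := S) a n) := by
  induction n with
  | zero => exact measurable_const
  | succ n ih =>
    have heval : ∀ t : ℝ≥0, Measurable fun p : ℝ≥0 → S => (p t : ℝ) := fun t =>
      measurable_subtype_coe.comp (measurable_pi_apply (X := fun _ : ℝ≥0 => S) t)
    refine Measurable.iInf fun i => Measurable.iInf fun j => Measurable.ite ?_ measurable_const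
      measurable_const
    exact (ih measurableSet_Iic).inter ((MeasurableSet.const _).inter
      (measurableSet_le measurable_const ((heval _).sub (heval _))))

lemma drawdownTime_eq_denseDrawdownTime (ha : 0 < a)
    (hY : ∀ t, ContinuousWithinAt (fun s => Y s ω) (Set.Ici t) t) (n : ℕ) :
    drawdownTime Y a n ω = denseDrawdownTime a n fun t => Y t ω := by
  induction n with
  | zero => rfl
  | succ n ih =>
    rw [drawdownTime_succ, denseDrawdownTime, ih]
    refine le_antisymm (le_iInf₂ fun i j => ?_)
      (le_iInf₂ fun t ht => le_of_forall_gt fun s hs => ?_)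
    · split_ifs with hij
      · obtain ⟨hi, hij, hdrop⟩ := hij
        exact iInf₂_le _ ⟨hi.trans_lt (ENNReal.coe_lt_coe.2 hij), _, hi, hij.le, hdrop⟩
      · exact le_top
    · obtain ⟨-, u, hτu, hut, hdrop⟩ := ht
      have hut' : u < t := hut.lt_of_ne fun h => by
        rw [h, sub_self] at hdrop
        exact hdrop.not_gt ha
      obtain ⟨s', hts', hs's⟩ := ENNReal.lt_iff_exists_nnreal_btwn.1 hs
      obtain ⟨i, hui, hit, hi⟩ := exists_denseSeq_eq (hY u) hut'
      obtain ⟨j, htj, hjs, hj⟩ := exists_denseSeq_eq (hY t) (ENNReal.coe_lt_coe.1 hts')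
      refine (iInf₂_le i j).trans_lt ?_
      rw [if_pos ⟨hτu.trans (ENNReal.coe_le_coe.2 hui.le), hit.trans htj, by rwa [hi, hj]⟩]
      exact (ENNReal.coe_lt_coe.2 hjs).trans hs's

end Drawdown

section Discount

lemma measurable_discount (q : ℂ) : Measurable (discount q) :=
  Measurable.ite measurableSet_Iio (by fun_prop) measurable_const

lemma discount_coe (q : ℂ) (t : ℝ≥0) : discount q t = Complex.exp (-q * (t : ℝ)) := by
  simp [discount]

lemma discount_top (q : ℂ) : discount q ⊤ = 0 := by
  simp [discount]

lemma discount_zero (q : ℂ) : discount q 0 = 1 := by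
  simp [discount]

lemma discount_coe_add (q : ℂ) (t : ℝ≥0) (τ : ℝ≥0∞) :
    discount q (t + τ) = discount q t * discount q τ := by
  induction τ with
  | top => simp [discount_top]
  | coe τ =>
    rw [← ENNReal.coe_add, discount_coe, discount_coe, discount_coe, ← Complex.exp_add]
    push_cast
    ring_nf

lemma norm_discount (q : ℂ) (τ : ℝ≥0∞) :
    ‖discount q τ‖ = if τ < ∞ then Real.exp (-q.re * τ.toReal) else 0 := by
  simp [discount, apply_ite norm, Complex.norm_exp]

variable {q : ℂ}

lemma norm_discount_lt_one (hq : 0 < q.re) {τ : ℝ≥0∞} (hτ : 0 < τ) : ‖discount q τ‖ < 1 := by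
  rw [norm_discount]
  split_ifs with h
  · rw [Real.exp_lt_one_iff]
    nlinarith [ENNReal.toReal_pos hτ.ne' h.ne]
  · exact zero_lt_one

lemma norm_discount_le_one (hq : 0 < q.re) (τ : ℝ≥0∞) : ‖discount q τ‖ ≤ 1 := by
  rcases eq_zero_or_pos τ with rfl | hτ
  · simp [discount_zero]
  · exact (norm_discount_lt_one hq hτ).le

variable {Ω : Type*} [MeasurableSpace Ω] {μ : Measure Ω} {τ : Ω → ℝ≥0∞}

lemma integrable_discount [IsFiniteMeasure μ] (hq : 0 < q.re) (hτ : Measurable τ) :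
    Integrable (fun ω => discount q (τ ω)) μ :=
  .of_bound ((measurable_discount q).comp hτ).aestronglyMeasurable 1
    (.of_forall fun _ => norm_discount_le_one hq _)

lemma integral_norm_discount_lt_one [IsProbabilityMeasure μ] (hq : 0 < q.re) (hτ : Measurable τ)
    (hpos : ∀ᵐ ω ∂μ, 0 < τ ω) : ∫ ω, ‖discount q (τ ω)‖ ∂μ < 1 := by
  obtain ⟨ω, hω, hle⟩ := exists_notMem_null_integral_le (integrable_discount hq hτ).norm hpos
  exact hle.trans_lt (norm_discount_lt_one hq (not_not.1 hω))

end Discount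

section Exit

variable {Ω : Type*} {S : Finset ℝ}

/-- The payoff `e^{-q T_A} 1_{Y_{T_A} = y}` at the first passage out of `A`. -/
abbrev exitPayoff (Y : ℝ≥0 → Ω → S) (A : Set ℝ) (q : ℂ) (y : S) : Ω → ℂ :=
  firstPassagePayoff Y A (fun _ => q) fun z => if z = y then 1 else 0

/-- The coefficient `P_A(q, x; 1_{· = y})` of the linear system. -/
abbrev exitTransform [MeasurableSpace Ω] (ℙ : S → Measure Ω) (Y : ℝ≥0 → Ω → S) (A : Set ℝ)
    (q : ℂ) (x y : S) : ℂ :=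
  firstPassageValue ℙ Y A (fun _ => q) x fun z => if z = y then 1 else 0

variable {Y : ℝ≥0 → Ω → S} {A : Set ℝ} {q : ℂ}

lemma exitPayoff_eq_indicator (Y : ℝ≥0 → Ω → S) (A : Set ℝ) (q : ℂ) (y : S) :
    exitPayoff Y A q y = (stoppedAt Y (firstPassageTime Y A) y).indicator
      fun ω => discount q (firstPassageTime Y A ω) := by
  classical
  funext ω
  by_cases hT : firstPassageTime Y A ω < ∞ <;>
    by_cases hy : Y (firstPassageTime Y A ω).toNNReal ω = y <;>
    simp [exitPayoff, firstPassagePayoff, stoppedAt, discount, hT, hy, mul_comm]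

lemma exitPayoff_of_top {ω : Ω} (hT : firstPassageTime Y A ω = ⊤) (q : ℂ) (y : S) :
    exitPayoff Y A q y ω = 0 := by
  simp [firstPassagePayoff, hT]

lemma exitPayoff_of_coe {ω : Ω} {T : ℝ≥0} (hT : firstPassageTime Y A ω = T) (q : ℂ) (y : S) :
    exitPayoff Y A q y ω = if Y T ω = y then discount q T else 0 := by
  simp [exitPayoff_eq_indicator, stoppedAt, Set.indicator_apply, hT]

lemma sum_norm_exitPayoff (Y : ℝ≥0 → Ω → S) (A : Set ℝ) (q : ℂ) (ω : Ω) :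
    ∑ y, ‖exitPayoff Y A q y ω‖ = ‖discount q (firstPassageTime Y A ω)‖ := by
  induction hT : firstPassageTime Y A ω with
  | top => simp [exitPayoff_of_top hT, discount_top]
  | coe T => simp [exitPayoff_of_coe hT, apply_ite norm]

variable [MeasurableSpace Ω] {ℙ : S → Measure Ω}

lemma IsMarkovFamily.isOptionalTime_firstPassageTime (hY : IsMarkovFamily ℙ Y) (A : Set ℝ) :
    IsOptionalTime Y (firstPassageTime Y A) :=
  _root_.isOptionalTime_firstPassageTime hY.rightContinuous A

lemma IsMarkovFamily.measurable_firstPassageTime (hY : IsMarkovFamily ℙ Y) (A : Set ℝ) :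
    Measurable (firstPassageTime Y A) :=
  (hY.isOptionalTime_firstPassageTime A).measurable hY.measurable

lemma IsMarkovFamily.integrable_exitPayoff (hY : IsMarkovFamily ℙ Y) (A : Set ℝ)
    (hq : 0 < q.re) (x y : S) : Integrable (exitPayoff Y A q y) (ℙ x) := by
  have := hY.isProbabilityMeasure x
  rw [exitPayoff_eq_indicator]
  exact (integrable_discount hq (hY.measurable_firstPassageTime A)).indicator
    (hY.measurableSet_stoppedAt (hY.isOptionalTime_firstPassageTime A) y)

lemma IsMarkovFamily.exitTransform_mul_integral (hY : IsMarkovFamily ℙ Y) (A : Set ℝ) (q : ℂ)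
    (x y : S) {g : (ℝ≥0 → S) → ℂ} (hg : Measurable g) :
    exitTransform ℙ Y A q x y * ∫ ω, g (fun t => Y t ω) ∂(ℙ y) =
      ∫ ω, exitPayoff Y A q y ω * g (shiftedPath Y (firstPassageTime Y A ω).toNNReal ω) ∂(ℙ x) := by
  have hT := hY.isOptionalTime_firstPassageTime A
  have hstopped := hY.measurableSet_stoppedAt hT y
  have hdiscount := (measurable_discount q).comp (hT.measurable_measurableSpace hY.measurable)
  have hmarkov := hY.setIntegral_mul_shiftedPath x y hT hdiscount hg
  rw [← integral_indicator hstopped, ← integral_indicator hstopped] at hmarkov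
  simp only [Set.indicator_mul_left] at hmarkov
  simp only [exitTransform, firstPassageValue, exitPayoff_eq_indicator]
  exact hmarkov.symm

lemma IsMarkovFamily.integrable_exitPayoff_mul (hY : IsMarkovFamily ℙ Y) (A : Set ℝ)
    (hq : 0 < q.re) (x y : S) {g : (ℝ≥0 → S) → ℂ} (hg : Measurable g) {c : ℝ}
    (hbound : ∀ p, ‖g p‖ ≤ c) :
    Integrable (fun ω => exitPayoff Y A q y ω *
      g (shiftedPath Y (firstPassageTime Y A ω).toNNReal ω)) (ℙ x) :=
  (hY.integrable_exitPayoff A hq x y).mul_bdd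
    (hg.comp (hY.measurable_shiftedPath
      (hY.measurable_firstPassageTime A).ennreal_toNNReal)).aestronglyMeasurable
    (.of_forall fun _ => hbound _)

lemma IsMarkovFamily.sum_norm_exitTransform_lt_one (hY : IsMarkovFamily ℙ Y) (hq : 0 < q.re)
    {x : S} (hx : (x : ℝ) ∈ A) : ∑ y, ‖exitTransform ℙ Y A q x y‖ < 1 := by
  have := hY.isProbabilityMeasure x
  have hpos : ∀ᵐ ω ∂(ℙ x), 0 < firstPassageTime Y A ω := by
    filter_upwards [hY.start x] with ω h0
    exact firstPassageTime_pos (hY.rightContinuous ω 0) (h0 ▸ hx)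
  calc ∑ y, ‖exitTransform ℙ Y A q x y‖
      ≤ ∑ y, ∫ ω, ‖exitPayoff Y A q y ω‖ ∂(ℙ x) :=
        Finset.sum_le_sum fun y _ => norm_integral_le_integral_norm _
    _ = ∫ ω, ‖discount q (firstPassageTime Y A ω)‖ ∂(ℙ x) := by
        rw [← integral_finsetSum _ fun y _ => (hY.integrable_exitPayoff A hq x y).norm]
        simp only [sum_norm_exitPayoff]
    _ < 1 := integral_norm_discount_lt_one hq (hY.measurable_firstPassageTime A) hpos

end Exit

section Renewal

lemma norm_sum_mul_add_sum_mul_le {R ι : Type*} [SeminormedRing R] [Fintype ι] (P : ι → R)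
    {D U : Finset ι} (hDU : Disjoint D U) (u v : ι → R) :
    ‖∑ y ∈ D, P y * u y + ∑ y ∈ U, P y * v y‖ ≤ (∑ y, ‖P y‖) * max ‖u‖ ‖v‖ := by
  classical
  have hterm : ∀ (w : ι → R), ‖w‖ ≤ max ‖u‖ ‖v‖ → ∀ y, ‖P y * w y‖ ≤ ‖P y‖ * max ‖u‖ ‖v‖ :=
    fun w hw y => (norm_mul_le _ _).trans (by gcongr; exact (norm_le_pi_norm w y).trans hw)
  calc ‖∑ y ∈ D, P y * u y + ∑ y ∈ U, P y * v y‖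
      ≤ ∑ y ∈ D, ‖P y‖ * max ‖u‖ ‖v‖ + ∑ y ∈ U, ‖P y‖ * max ‖u‖ ‖v‖ :=
        norm_add_le_of_le (norm_sum_le_of_le _ fun y _ => hterm u (le_max_left _ _) y)
          (norm_sum_le_of_le _ fun y _ => hterm v (le_max_right _ _) y)
    _ = ∑ y ∈ D ∪ U, ‖P y‖ * max ‖u‖ ‖v‖ := (Finset.sum_union hDU).symm
    _ ≤ ∑ y, ‖P y‖ * max ‖u‖ ‖v‖ :=
        Finset.sum_le_sum_of_subset_of_nonneg (Finset.subset_univ _) fun _ _ _ => by positivity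
    _ = (∑ y, ‖P y‖) * max ‖u‖ ‖v‖ := (Finset.sum_mul _ _ _).symm

lemma summable_of_norm_succ_le_mul_max {E : Type*} [SeminormedAddCommGroup E] [CompleteSpace E]
    {f : ℕ → E} {ρ : ℝ} (hρ : ρ < 1) (h : ∀ k, ‖f (k + 1)‖ ≤ ρ * max ‖f k‖ ‖f (k + 1)‖) :
    Summable f := by
  refine summable_of_ratio_norm_eventually_le hρ (.of_forall fun k => ?_)
  have hle : ‖f (k + 1)‖ ≤ ‖f k‖ := by
    by_contra! hlt
    have hk := h k
    rw [max_eq_right hlt.le] at hk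
    nlinarith [norm_nonneg (f k)]
  simpa only [max_eq_left hle] using h k

lemma summable_of_renewal {R ι : Type*} [SeminormedRing R] [CompleteSpace R] [Fintype ι]
    {P : ι → ι → R} {D U : ι → Finset ι} (hDU : ∀ x, Disjoint (D x) (U x))
    (hP : ∀ x, ∑ y, ‖P x y‖ < 1) {h : ℕ → ι → R}
    (hrec : ∀ k x, h (k + 1) x = ∑ y ∈ D x, P x y * h k y + ∑ y ∈ U x, P x y * h (k + 1) y) :
    Summable h := by
  rcases isEmpty_or_nonempty ι with hι | hι
  · exact summable_zero.congr fun _ => Subsingleton.elim _ _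
  obtain ⟨x₀, hx₀⟩ := Finite.exists_max fun x => ∑ y, ‖P x y‖
  refine summable_of_norm_succ_le_mul_max (hP x₀) fun k => ?_
  refine (pi_norm_le_iff_of_nonneg (by positivity)).2 fun x => ?_
  rw [hrec]
  exact (norm_sum_mul_add_sum_mul_le (P x) (hDU x) _ _).trans
    (mul_le_mul_of_nonneg_right (hx₀ x) (le_max_of_le_left (norm_nonneg _)))

variable {Ω : Type*} {S : Finset ℝ} {Y : ℝ≥0 → Ω → S} {a : ℝ} {q : ℂ} {x : S}

lemma discount_drawdownTime_succ (ha : 0 < a) (q : ℂ) (k : ℕ) {ω : Ω}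
    (hY : ∀ t, ContinuousWithinAt (fun s => Y s ω) (Set.Ici t) t) (h0 : Y 0 ω = x) :
    discount q (drawdownTime Y a (k + 1) ω) =
      ∑ y ∈ Finset.univ.filter (fun y : S => (y : ℝ) ≤ (x : ℝ) - a),
        exitPayoff Y (Set.Ioc ((x : ℝ) - a) x) q y ω *
          discount q (denseDrawdownTime a k
            (shiftedPath Y (firstPassageTime Y (Set.Ioc ((x : ℝ) - a) x) ω).toNNReal ω)) +
      ∑ y ∈ Finset.univ.filter (fun y : S => (x : ℝ) < (y : ℝ)),
        exitPayoff Y (Set.Ioc ((x : ℝ) - a) x) q y ω *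
          discount q (denseDrawdownTime a (k + 1)
            (shiftedPath Y (firstPassageTime Y (Set.Ioc ((x : ℝ) - a) x) ω).toNNReal ω)) := by
  have hdense : ∀ (T : ℝ≥0) n, drawdownTime (fun t => Y (T + t)) a n ω =
      denseDrawdownTime a n (shiftedPath Y T ω) := fun T =>
    drawdownTime_eq_denseDrawdownTime ha fun t => (hY (T + t)).comp
      (f := fun t => T + t) (by fun_prop) fun s hs => add_le_add_right hs T
  induction hT : firstPassageTime Y (Set.Ioc ((x : ℝ) - a) x) ω with
  | top => simp [drawdownTime_eq_top ha h0 hT, exitPayoff_of_top hT, discount_top]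
  | coe T =>
    simp only [exitPayoff_of_coe hT, ite_mul, zero_mul, Finset.sum_ite_eq, Finset.mem_filter,
      Finset.mem_univ, true_and, ENNReal.toNNReal_coe, ← hdense, ← discount_coe_add]
    rcases le_or_gt (Y T ω : ℝ) (x - a) with hdown | hdown
    · rw [if_pos hdown, if_neg (by linarith), add_zero, drawdownTime_of_down ha h0 hT hdown]
    · have hup : (x : ℝ) < Y T ω :=
        lt_of_not_ge fun h => notMem_of_firstPassageTime_eq (hY T) hT ⟨hdown, h⟩
      rw [if_neg hdown.not_ge, if_pos hup, zero_add, drawdownTime_of_up ha h0 hT hup]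

variable [MeasurableSpace Ω] {ℙ : S → Measure Ω}

lemma IsMarkovFamily.measurable_drawdownTime (hY : IsMarkovFamily ℙ Y) (ha : 0 < a) (n : ℕ) :
    Measurable (drawdownTime Y a n) := by
  have hdense : drawdownTime Y a n = fun ω => denseDrawdownTime a n fun t => Y t ω :=
    funext fun ω => drawdownTime_eq_denseDrawdownTime ha (hY.rightContinuous ω) n
  exact hdense ▸ (measurable_denseDrawdownTime a n).comp (measurable_pi_lambda _ hY.measurable)

lemma IsMarkovFamily.exitTransform_mul_drawdownTransform (hY : IsMarkovFamily ℙ Y) (ha : 0 < a)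
    (A : Set ℝ) (q : ℂ) (n : ℕ) (x y : S) :
    exitTransform ℙ Y A q x y * drawdownTransform ℙ Y a q n y =
      ∫ ω, exitPayoff Y A q y ω * discount q (denseDrawdownTime a n
        (shiftedPath Y (firstPassageTime Y A ω).toNNReal ω)) ∂(ℙ x) := by
  have hmeas := (measurable_discount q).comp (measurable_denseDrawdownTime (S := S) a n)
  simp only [drawdownTransform, drawdownTime_eq_denseDrawdownTime ha (hY.rightContinuous _)]
  exact hY.exitTransform_mul_integral A q x y hmeas

lemma IsMarkovFamily.drawdownTransform_succ (hY : IsMarkovFamily ℙ Y) (ha : 0 < a)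
    (hq : 0 < q.re) (k : ℕ) (x : S) :
    drawdownTransform ℙ Y a q (k + 1) x =
      ∑ y ∈ Finset.univ.filter (fun y : S => (y : ℝ) ≤ (x : ℝ) - a),
        exitTransform ℙ Y (Set.Ioc ((x : ℝ) - a) x) q x y * drawdownTransform ℙ Y a q k y +
      ∑ y ∈ Finset.univ.filter (fun y : S => (x : ℝ) < (y : ℝ)),
        exitTransform ℙ Y (Set.Ioc ((x : ℝ) - a) x) q x y *
          drawdownTransform ℙ Y a q (k + 1) y := by
  have hint : ∀ (n : ℕ) (y : S), Integrable (fun ω =>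
      exitPayoff Y (Set.Ioc ((x : ℝ) - a) x) q y ω * discount q (denseDrawdownTime a n
        (shiftedPath Y (firstPassageTime Y (Set.Ioc ((x : ℝ) - a) x) ω).toNNReal ω)))
      (ℙ x) := fun n y =>
    hY.integrable_exitPayoff_mul _ hq x y
      ((measurable_discount q).comp (measurable_denseDrawdownTime a n))
      fun _ => norm_discount_le_one hq _
  simp only [hY.exitTransform_mul_drawdownTransform ha]
  rw [← integral_finsetSum _ fun y _ => hint k y, ← integral_finsetSum _ fun y _ => hint (k + 1) y,
    ← integral_add (integrable_finsetSum _ fun y _ => hint k y)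
      (integrable_finsetSum _ fun y _ => hint (k + 1) y)]
  refine integral_congr_ae ?_
  filter_upwards [hY.start x] with ω h0
  exact discount_drawdownTime_succ ha q k (hY.rightContinuous ω) h0

lemma IsMarkovFamily.summable_drawdownTransform (hY : IsMarkovFamily ℙ Y) (ha : 0 < a)
    (hq : 0 < q.re) (x : S) : Summable fun k => drawdownTransform ℙ Y a q k x := by
  have hdisjoint : ∀ x : S, Disjoint (Finset.univ.filter fun y : S => (y : ℝ) ≤ (x : ℝ) - a)
      (Finset.univ.filter fun y : S => (x : ℝ) < (y : ℝ)) := fun x =>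
    Finset.disjoint_filter.2 fun y _ hdown hup => by linarith
  have hlt : ∀ x : S, ∑ y, ‖exitTransform ℙ Y (Set.Ioc ((x : ℝ) - a) x) q x y‖ < 1 := fun x =>
    hY.sum_norm_exitTransform_lt_one hq ⟨by linarith, le_rfl⟩
  exact Pi.summable.1 (summable_of_renewal hdisjoint hlt (hY.drawdownTransform_succ ha hq)) x

lemma IsMarkovFamily.summable_drawdownTransform_succ (hY : IsMarkovFamily ℙ Y) (ha : 0 < a)
    (hq : 0 < q.re) (x : S) : Summable fun k => drawdownTransform ℙ Y a q (k + 1) x :=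
  (summable_nat_add_iff 1).2 (hY.summable_drawdownTransform ha hq x)

lemma IsMarkovFamily.drawdownTransform_zero (hY : IsMarkovFamily ℙ Y) (a : ℝ) (q : ℂ) (x : S) :
    drawdownTransform ℙ Y a q 0 x = 1 := by
  have := hY.isProbabilityMeasure x
  simp [drawdownTransform, drawdownTime, discount_zero]

lemma IsMarkovFamily.drawdownSeries_eq (hY : IsMarkovFamily ℙ Y) (ha : 0 < a) (hq : 0 < q.re)
    (x : S) :
    drawdownSeries ℙ Y a q x =
      ∑ y ∈ Finset.univ.filter (fun y : S => (y : ℝ) ≤ (x : ℝ) - a),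
        exitTransform ℙ Y (Set.Ioc ((x : ℝ) - a) x) q x y * (1 + drawdownSeries ℙ Y a q y) +
      ∑ y ∈ Finset.univ.filter (fun y : S => (x : ℝ) < (y : ℝ)),
        exitTransform ℙ Y (Set.Ioc ((x : ℝ) - a) x) q x y * drawdownSeries ℙ Y a q y := by
  have hsucc : ∀ y, HasSum (fun k => drawdownTransform ℙ Y a q (k + 1) y)
      (drawdownSeries ℙ Y a q y) := fun y => (hY.summable_drawdownTransform_succ ha hq y).hasSum
  have hall : ∀ y, HasSum (fun k => drawdownTransform ℙ Y a q k y)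
      (1 + drawdownSeries ℙ Y a q y) := fun y =>
    hY.drawdownTransform_zero a q y ▸ (hsucc y).zero_add
  refine (hsucc x).unique ?_
  simp only [hY.drawdownTransform_succ ha hq _ x]
  exact (hasSum_sum fun y _ => (hall y).mul_left _).add (hasSum_sum fun y _ => (hsucc y).mul_left _)

end Renewal

section Laplace

/-- The payment at time `τ`, discounted at the rate `r`, if `τ` precedes the maturity `T`: the
function of the drawdown time in `insurancePayment`. -/
def paymentBefore (r T : ℝ) (τ : ℝ≥0∞) : ℝ :=
  if τ < ENNReal.ofReal T then Real.exp (-r * τ.toReal) else 0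

lemma measurable_paymentBefore_uncurry (r : ℝ) :
    Measurable fun z : ℝ × ℝ≥0∞ => paymentBefore r z.1 z.2 :=
  Measurable.ite (measurableSet_lt measurable_snd (by fun_prop)) (by fun_prop) measurable_const

lemma measurable_paymentBefore (r T : ℝ) : Measurable (paymentBefore r T) :=
  (measurable_paymentBefore_uncurry r).comp measurable_prodMk_left

lemma exp_mul_paymentBefore_coe (q : ℂ) (r : ℝ) (t : ℝ≥0) :
    (fun T : ℝ => Complex.exp (-q * T) * (paymentBefore r T t : ℂ)) =
      (Set.Ioi (t : ℝ)).indicator fun T => Complex.exp (-q * T) * Complex.exp (-r * (t : ℝ)) := by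
  funext T
  simp only [paymentBefore, ENNReal.lt_ofReal_iff_toReal_lt ENNReal.coe_ne_top,
    ENNReal.coe_toReal, Set.indicator_apply, Set.mem_Ioi]
  split_ifs <;> simp

lemma setIntegral_Ioi_zero_indicator_Ioi {E : Type*} [NormedAddCommGroup E] [NormedSpace ℝ E]
    (t : ℝ≥0) (f : ℝ → E) :
    ∫ T in Set.Ioi (0 : ℝ), (Set.Ioi (t : ℝ)).indicator f T = ∫ T in Set.Ioi (t : ℝ), f T := by
  rw [setIntegral_indicator measurableSet_Ioi,
    Set.inter_eq_right.2 (Set.Ioi_subset_Ioi t.coe_nonneg)]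

variable {q : ℂ} {r : ℝ}

lemma integrableOn_exp_mul_paymentBefore (hq : 0 < q.re) (r : ℝ) (τ : ℝ≥0∞) :
    IntegrableOn (fun T : ℝ => Complex.exp (-q * T) * (paymentBefore r T τ : ℂ)) (Set.Ioi 0) := by
  induction τ with
  | top => simp [paymentBefore]
  | coe t =>
    rw [exp_mul_paymentBefore_coe]
    exact ((integrable_indicator_iff measurableSet_Ioi).2
      ((integrableOn_exp_mul_complex_Ioi (by simpa using hq) _).mul_const _)).integrableOn

lemma integral_exp_mul_paymentBefore (hq : 0 < q.re) (r : ℝ) (τ : ℝ≥0∞) :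
    ∫ T in Set.Ioi (0 : ℝ), Complex.exp (-q * T) * (paymentBefore r T τ : ℂ) =
      discount (q + r) τ / q := by
  induction τ with
  | top => simp [paymentBefore, discount_top]
  | coe t =>
    rw [exp_mul_paymentBefore_coe, setIntegral_Ioi_zero_indicator_Ioi, integral_mul_const,
      integral_exp_mul_complex_Ioi (by simpa using hq), discount_coe, neg_div_neg_eq,
      div_mul_eq_mul_div, ← Complex.exp_add]
    ring_nf

lemma integral_norm_exp_mul_paymentBefore (hq : 0 < q.re) (r : ℝ) (τ : ℝ≥0∞) :
    ∫ T in Set.Ioi (0 : ℝ), ‖Complex.exp (-q * T) * (paymentBefore r T τ : ℂ)‖ =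
      ‖discount (q + r) τ‖ / q.re := by
  induction τ with
  | top => simp [paymentBefore, discount_top]
  | coe t =>
    have hexp := congrFun (exp_mul_paymentBefore_coe q r t)
    simp only [hexp, norm_indicator_eq_indicator_norm, setIntegral_Ioi_zero_indicator_Ioi, norm_mul,
      integral_mul_const, discount_coe, Complex.norm_exp]
    have hre : ∀ T : ℝ, (-q * T).re = -q.re * T := fun T => by simp
    simp only [hre, integral_exp_mul_Ioi (neg_neg_of_pos hq), neg_div_neg_eq,
      div_mul_eq_mul_div, ← Real.exp_add]
    congr 2
    simp
    ring

lemma norm_paymentBefore_le (hq : 0 ≤ q.re) (r T : ℝ) (τ : ℝ≥0∞) :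
    ‖paymentBefore r T τ‖ ≤ Real.exp (q.re * T) * ‖discount (q + r) τ‖ := by
  unfold paymentBefore
  split_ifs with hτ
  · have hfin : τ < ∞ := hτ.trans ENNReal.ofReal_lt_top
    have hle := ((ENNReal.lt_ofReal_iff_toReal_lt hfin.ne).1 hτ).le
    rw [Real.norm_of_nonneg (Real.exp_nonneg _), norm_discount, if_pos hfin, ← Real.exp_add,
      Real.exp_le_exp, Complex.add_re, Complex.ofReal_re]
    nlinarith
  · rw [norm_zero]
    positivity

variable {ν : Measure ℝ≥0∞}

lemma integrable_paymentBefore (hq : 0 ≤ q.re) (hν : Integrable (discount (q + r)) ν) (T : ℝ) :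
    Integrable (paymentBefore r T) ν :=
  (hν.norm.const_mul (Real.exp (q.re * T))).mono'
    (measurable_paymentBefore r T).aestronglyMeasurable
    (.of_forall fun τ => norm_paymentBefore_le hq r T τ)

variable [SFinite ν]

lemma integrable_prod_exp_mul_paymentBefore (hq : 0 < q.re)
    (hν : Integrable (discount (q + r)) ν) :
    Integrable (fun z : ℝ × ℝ≥0∞ => Complex.exp (-q * z.1) * (paymentBefore r z.1 z.2 : ℂ))
      ((volume.restrict (Set.Ioi 0)).prod ν) := by
  have hmeas : Measurable fun z : ℝ × ℝ≥0∞ =>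
      Complex.exp (-q * z.1) * (paymentBefore r z.1 z.2 : ℂ) :=
    Measurable.mul (by fun_prop)
      (Complex.measurable_ofReal.comp (measurable_paymentBefore_uncurry r))
  refine (integrable_prod_iff' hmeas.aestronglyMeasurable).2
    ⟨.of_forall (integrableOn_exp_mul_paymentBefore hq r), ?_⟩
  simp only [integral_norm_exp_mul_paymentBefore hq]
  exact hν.norm.div_const _

lemma integrableOn_exp_mul_integral_paymentBefore (hq : 0 < q.re)
    (hν : Integrable (discount (q + r)) ν) :
    IntegrableOn (fun T : ℝ => Complex.exp (-q * T) * ((∫ τ, paymentBefore r T τ ∂ν : ℝ) : ℂ))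
      (Set.Ioi 0) := by
  simpa only [IntegrableOn, integral_const_mul, integral_complex_ofReal] using
    (integrable_prod_exp_mul_paymentBefore hq hν).integral_prod_left

lemma integral_exp_mul_integral_paymentBefore (hq : 0 < q.re)
    (hν : Integrable (discount (q + r)) ν) :
    ∫ T in Set.Ioi (0 : ℝ), Complex.exp (-q * T) * ((∫ τ, paymentBefore r T τ ∂ν : ℝ) : ℂ) =
      (∫ τ, discount (q + r) τ ∂ν) / q := by
  calc ∫ T in Set.Ioi (0 : ℝ), Complex.exp (-q * T) * ((∫ τ, paymentBefore r T τ ∂ν : ℝ) : ℂ)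
      = ∫ T in Set.Ioi (0 : ℝ), ∫ τ, Complex.exp (-q * T) * (paymentBefore r T τ : ℂ) ∂ν := by
        simp only [integral_const_mul, integral_complex_ofReal]
    _ = ∫ τ, (∫ T in Set.Ioi (0 : ℝ), Complex.exp (-q * T) * (paymentBefore r T τ : ℂ)) ∂ν :=
        integral_integral_swap (integrable_prod_exp_mul_paymentBefore hq hν)
    _ = (∫ τ, discount (q + r) τ ∂ν) / q := by
        simp only [integral_exp_mul_paymentBefore hq, integral_div]

end Laplace

section Intensity

variable {Ω : Type*} [MeasurableSpace Ω] {S : Finset ℝ} {ℙ : S → Measure Ω} {Y : ℝ≥0 → Ω → S}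
  {a : ℝ} {q : ℂ}

/-- The intensity measure of the drawdown times `τ₁, τ₂, …` under `ℙ x`: integrating against it
exchanges the sum over drawdowns with the expectation. It may charge `∞`, where discount factors
and payments vanish. -/
def drawdownIntensity (ℙ : S → Measure Ω) (Y : ℝ≥0 → Ω → S) (a : ℝ) (x : S) : Measure ℝ≥0∞ :=
  Measure.sum fun k => (ℙ x).map (drawdownTime Y a (k + 1))

lemma IsMarkovFamily.sFinite_drawdownIntensity (hY : IsMarkovFamily ℙ Y) (a : ℝ) (x : S) :
    SFinite (drawdownIntensity ℙ Y a x) := by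
  have := hY.isProbabilityMeasure x
  unfold drawdownIntensity
  infer_instance

lemma IsMarkovFamily.hasSum_integral_drawdownIntensity (hY : IsMarkovFamily ℙ Y) (ha : 0 < a)
    {x : S} {E : Type*} [NormedAddCommGroup E] [NormedSpace ℝ E] {f : ℝ≥0∞ → E}
    (hf : Integrable f (drawdownIntensity ℙ Y a x)) :
    HasSum (fun k => ∫ ω, f (drawdownTime Y a (k + 1) ω) ∂(ℙ x))
      (∫ τ, f τ ∂drawdownIntensity ℙ Y a x) := by
  refine (hasSum_integral_measure hf).congr_fun fun k => ?_
  exact (integral_map (hY.measurable_drawdownTime ha _).aemeasurable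
    (hf.mono_measure (Measure.le_sum _ k)).aestronglyMeasurable).symm

lemma IsMarkovFamily.integrable_discount_drawdownTime (hY : IsMarkovFamily ℙ Y) (ha : 0 < a)
    (hq : 0 < q.re) (n : ℕ) (x : S) :
    Integrable (fun ω => discount q (drawdownTime Y a n ω)) (ℙ x) :=
  have := hY.isProbabilityMeasure x
  integrable_discount hq (hY.measurable_drawdownTime ha n)

lemma IsMarkovFamily.integrable_discount_map_drawdownTime (hY : IsMarkovFamily ℙ Y) (ha : 0 < a)
    (hq : 0 < q.re) (n : ℕ) (x : S) :
    Integrable (discount q) ((ℙ x).map (drawdownTime Y a n)) :=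
  (integrable_map_measure (measurable_discount q).aestronglyMeasurable
    (hY.measurable_drawdownTime ha n).aemeasurable).2
    (hY.integrable_discount_drawdownTime ha hq n x)

lemma norm_discount_eq_discount_re (q : ℂ) (τ : ℝ≥0∞) :
    (‖discount q τ‖ : ℂ) = discount q.re τ := by
  rw [norm_discount, discount]
  split_ifs <;> simp

lemma IsMarkovFamily.integrable_discount_drawdownIntensity (hY : IsMarkovFamily ℙ Y)
    (ha : 0 < a) (hq : 0 < q.re) (x : S) :
    Integrable (discount q) (drawdownIntensity ℙ Y a x) := by
  have hmap : ∀ k, ∫ τ, ‖discount q τ‖ ∂(ℙ x).map (drawdownTime Y a k) =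
      ‖drawdownTransform ℙ Y a q.re k x‖ := fun k => by
    rw [integral_map (hY.measurable_drawdownTime ha k).aemeasurable
      (measurable_discount q).norm.aestronglyMeasurable, drawdownTransform]
    simp only [← norm_discount_eq_discount_re, integral_complex_ofReal, Complex.norm_real]
    exact (Real.norm_of_nonneg (integral_nonneg fun _ => norm_nonneg _)).symm
  refine integrable_sum_measure
    (fun k => hY.integrable_discount_map_drawdownTime ha hq (k + 1) x) ?_
  simp only [hmap]
  exact (hY.summable_drawdownTransform_succ ha (q := q.re) (by simpa using hq) x).norm

lemma IsMarkovFamily.drawdownSeries_eq_integral (hY : IsMarkovFamily ℙ Y) (ha : 0 < a)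
    (hq : 0 < q.re) (x : S) :
    drawdownSeries ℙ Y a q x = ∫ τ, discount q τ ∂drawdownIntensity ℙ Y a x :=
  (hY.hasSum_integral_drawdownIntensity ha
    (hY.integrable_discount_drawdownIntensity ha hq x)).tsum_eq

variable {r : ℝ}

lemma IsMarkovFamily.integrable_insurancePayment (hY : IsMarkovFamily ℙ Y) (ha : 0 < a)
    (r T : ℝ) (n : ℕ) (x : S) : Integrable (insurancePayment Y a r T n) (ℙ x) := by
  have hre : 0 < ((|r| + 1 : ℝ) + (r : ℂ)).re := by
    rw [Complex.add_re, Complex.ofReal_re, Complex.ofReal_re]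
    linarith [neg_abs_le r]
  exact (integrable_paymentBefore (q := (|r| + 1 : ℝ)) (by rw [Complex.ofReal_re]; positivity)
    (hY.integrable_discount_map_drawdownTime ha hre n x) T).comp_measurable
    (hY.measurable_drawdownTime ha n)

lemma IsMarkovFamily.hasSum_integral_insurancePayment (hY : IsMarkovFamily ℙ Y) (ha : 0 < a)
    (hq : 0 ≤ q.re) (hr : 0 < q.re + r) (T : ℝ) (x : S) :
    HasSum (fun k => ∫ ω, insurancePayment Y a r T (k + 1) ω ∂(ℙ x))
      (∫ τ, paymentBefore r T τ ∂drawdownIntensity ℙ Y a x) :=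
  hY.hasSum_integral_drawdownIntensity ha (integrable_paymentBefore hq
    (hY.integrable_discount_drawdownIntensity ha (q := q + r) (by simpa using hr) x) T)

end Intensity

end

theorem mainTheorem7_general {Ω : Type*} [MeasurableSpace Ω] (S : Finset ℝ)
    (ℙ : S → Measure Ω) (Y : ℝ≥0 → Ω → S) (hY : IsMarkovFamily ℙ Y)
    (a : ℝ) (ha : 0 < a) (q : ℂ) (hq : 0 < q.re) (x : S) :
    (∀ y : S, Integrable (exitPayoff Y (Set.Ioc ((x : ℝ) - a) x) q y) (ℙ x)) ∧
    (∀ n : ℕ, Integrable (fun ω => discount q (drawdownTime Y a n ω)) (ℙ x)) ∧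
    Summable (fun k : ℕ => drawdownTransform ℙ Y a q (k + 1) x) ∧
    drawdownSeries ℙ Y a q x =
      (∑ y ∈ Finset.univ.filter (fun y : S => (y : ℝ) ≤ (x : ℝ) - a),
        exitTransform ℙ Y (Set.Ioc ((x : ℝ) - a) x) q x y * (1 + drawdownSeries ℙ Y a q y)) +
      ∑ y ∈ Finset.univ.filter (fun y : S => (x : ℝ) < (y : ℝ)),
        exitTransform ℙ Y (Set.Ioc ((x : ℝ) - a) x) q x y * drawdownSeries ℙ Y a q y ∧
    ∀ r : ℝ, 0 < q.re + r →
      (∀ T : ℝ, 0 < T →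
        (∀ n : ℕ, Integrable (insurancePayment Y a r T n) (ℙ x)) ∧
        Summable (fun k : ℕ => ∫ ω, insurancePayment Y a r T (k + 1) ω ∂(ℙ x))) ∧
      IntegrableOn (fun T : ℝ => Complex.exp (-q * (T : ℂ)) * (insurancePrice ℙ Y a r T x : ℂ))
        (Set.Ioi 0) ∧
      ∫ T in Set.Ioi (0 : ℝ), Complex.exp (-q * (T : ℂ)) * (insurancePrice ℙ Y a r T x : ℂ) =
        drawdownSeries ℙ Y a (q + (r : ℂ)) x / q := by
  refine ⟨hY.integrable_exitPayoff _ hq x, fun n => hY.integrable_discount_drawdownTime ha hq n x,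
    hY.summable_drawdownTransform_succ ha hq x, hY.drawdownSeries_eq ha hq x, fun r hr => ?_⟩
  have := hY.sFinite_drawdownIntensity a x
  have hre : 0 < (q + r).re := by simpa using hr
  have hν := hY.integrable_discount_drawdownIntensity ha hre x
  have hsum := fun T => hY.hasSum_integral_insurancePayment ha hq.le hr T x
  have hprice : ∀ T, insurancePrice ℙ Y a r T x =
      ∫ τ, paymentBefore r T τ ∂drawdownIntensity ℙ Y a x := fun T => (hsum T).tsum_eq
  simp only [hprice, hY.drawdownSeries_eq_integral ha hre]
  exact ⟨fun T _ => ⟨fun n => hY.integrable_insurancePayment ha r T n x, (hsum T).summable⟩,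
    integrableOn_exp_mul_integral_paymentBefore hq hν,
    integral_exp_mul_integral_paymentBefore hq hν⟩

theorem mainTheorem7 {Ω : Type*} [MeasurableSpace Ω] (S : Finset ℝ) (G : Matrix S S ℝ)
    (hG : IsRateMatrix G)
    (hleft : ∀ x : S, (∀ y : S, x ≤ y) → IsAbsorbingState G x)
    (hright : ∀ x : S, (∀ y : S, y ≤ x) → IsAbsorbingState G x)
    (ℙ : S → Measure Ω) (Y : ℝ≥0 → Ω → S) (hY : IsCTMC G ℙ Y)
    (a : ℝ) (ha : 0 < a) (q : ℂ) (hq : 0 < q.re) (x : S) :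
    -- the expectations and the series that define the coefficients and `H(q, x)` converge
    (∀ y : S, Integrable (firstPassagePayoff Y (Set.Ioc ((x : ℝ) - a) x) (fun _ => q)
        (fun z => if z = y then 1 else 0)) (ℙ x)) ∧
    (∀ n : ℕ, Integrable (fun ω => discount q (drawdownTime Y a n ω)) (ℙ x)) ∧
    Summable (fun k : ℕ => drawdownTransform ℙ Y a q (k + 1) x) ∧
    -- the linear system
    drawdownSeries ℙ Y a q x =
      (∑ y ∈ Finset.univ.filter (fun y : S => (y : ℝ) ≤ (x : ℝ) - a),
        firstPassageValue ℙ Y (Set.Ioc ((x : ℝ) - a) x) (fun _ => q) x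
          (fun z => if z = y then 1 else 0) * (1 + drawdownSeries ℙ Y a q y)) +
      ∑ y ∈ Finset.univ.filter (fun y : S => (x : ℝ) < (y : ℝ)),
        firstPassageValue ℙ Y (Set.Ioc ((x : ℝ) - a) x) (fun _ => q) x
          (fun z => if z = y then 1 else 0) * drawdownSeries ℙ Y a q y ∧
    -- the Laplace transform in the maturity of the price of the drawdown insurance
    ∀ r : ℝ, 0 < q.re + r →
      (∀ T : ℝ, 0 < T →
        (∀ n : ℕ, Integrable (insurancePayment Y a r T n) (ℙ x)) ∧
        Summable (fun k : ℕ => ∫ ω, insurancePayment Y a r T (k + 1) ω ∂(ℙ x))) ∧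
      IntegrableOn (fun T : ℝ => Complex.exp (-q * (T : ℂ)) * (insurancePrice ℙ Y a r T x : ℂ))
        (Set.Ioi 0) ∧
      ∫ T in Set.Ioi (0 : ℝ), Complex.exp (-q * (T : ℂ)) * (insurancePrice ℙ Y a r T x : ℂ) =
        drawdownSeries ℙ Y a (q + (r : ℂ)) x / q :=
  mainTheorem7_general S ℙ Y hY.isMarkovFamily a ha q hq x
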